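/- **Setting.** Let $A$ be a finite alphabet partitioned as $A=V\uplus C\uplus N$ (visible, confidential, internal events), $\overline B=A\setminus B$, and let $\pi_B$ erase all letters outside $B\subseteq A$. A *rational observer* is a relation $\mathcal O\subseteq A^*\times B^*$ between words over finite alphabets that is realized by a finite transducer (finitely many states, and finitely many transitions labelled in $A^*\times B^*$); $\mathcal O(L)=\bigcup_{w\in L}\mathcal O(w)$. For a family $\mathcal L$ of languages over $A$, $RIF(\mathcal L)$ is the set of properties $\varphi$ for which there are two fixed expressions $E_1,E_2$ (denoting languages over a common finite alphabet) of the grammar $E::=L\mid\mathcal O(E)\mid E\cup E\mid E\cap E$, $\mathcal O$ a rational observer, such that every $L\in\mathcal L$ satisfies $\varphi(L)\iff E_1(L)\subseteq E_2(L)$. For $w,w'\in A^*$ write $w\sim w'$ if $\pi_{\overline N}(w)=\pi_{\overline N}(w')$. Let $X\subseteq A$, $V'\subseteq V$, $C'\subseteq C$, $N'\subseteq N$; say that $c$ is *admissible* after $w_1$ if some $w_3c\in L$ has $\pi_X(w_3)=\pi_X(w_1)$. The fourteen basic security predicates of $L\subseteq A^*$ are: * $SR$: $\pi_{\overline C}(w)\in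 L$ for all $w\in L$. $R$: for all $w\in L$ there is $w'\in L$ with $\pi_C(w')=\varepsilon$, $\pi_V(w')=\pi_V(w)$. * For all $w_1cw_2\in L$ with $c\in C$, $\pi_C(w_2)=\varepsilon$: $w_1w_2\in L$ ($SD$); $w_1'w_2'\in L$ for some $w_1'\sim w_1$, $w_2'\sim w_2$ ($D$); $w_1w_2'\in L$ for some $w_2'\sim w_2$ ($BSD$). * $FCD$: for all $w_1cvw_2\in L$ with $c\in C'$, $v\in V'$, $\pi_C(w_2)=\varepsilon$ there are $\delta\in N'^*$, $w_2'\sim w_2$ with $w_1\delta vw_2'\in L$. * For all $w_1w_2\in L$ with $\pi_C(w_2)=\varepsilon$ and all $c\in C$: $w_1cw_2\in L$ ($SI$); $w_1'cw_2'\in L$ for some $w_1'\sim w_1$, $w_2'\sim w_2$ ($I$); $w_1cw_2'\in L$ for some $w_2'\sim w_2$ ($BSI$). * $FCI$: for all $w_1vw_2\in L$ with $v\in V'$, $\pi_C(w_2)=\varepsilon$ and all $c\in C'$ there are $\delta\in N'^*$, $w_2'\sim w_2$ with $w_1c\delta vw_2'\in L$. * $SIA^X, IA^X, BSIA^X, FCIA^X$: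 as $SI,I,BSI,FCI$, but only for those $c$ that are admissible after $w_1$. **Proposition.** (1) For every family $\mathcal L$ of languages over $A$, each of these predicates (for all choices of its parameters) belongs to $RIF(\mathcal L)$. (2) Explicitly, let $w_2$ below always satisfy $\pi_C(w_2)=\varepsilon$, let $\#\notin A$ be a fresh letter, let $E\subseteq C$, and define the relations: * $l\text{-}del$: the function that deletes the last letter of $C$ (identity if there is none); $\mathcal O_{ld}=\mathrm{Id}\cup l\text{-}del$; $\mathcal O_{del}=\bigcup_{k\ge0}l\text{-}del^k$; * $ins_E=\mathrm{Id}\cup\{(w_1w_2,\,w_1cw_2): c\in E\}$; $\ \mathcal O_c^X(u)=\pi_X^{-1}(\pi_X(c^{-1}u))\,c\,(V\cup N)^*$, where $c^{-1}u=\{u_1: u_1c=u\}$; * $BSD_1=\mathrm{Id}\cup\{(w_1cw_2,\,w_1\#\pi_V(w_2)): c\in C\}$, $\ BSD_2=\mathrm{Id}\cup\{(w_1w_2,\,w_1\#\pi_V(w_2))\}$; * $FCD_1=\mathrm{Id}\cup\{(w_1cvw_2,\,w_1\#v\pi_V(w_2)): c\in C',v\in V'\}$, $\ FCD_2=\mathrm{Id}\cup\{(w_1\delta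 vw_2,\,w_1\#v\pi_V(w_2)):\delta\in N'^*,v\in V'\}$; * $BSI_{1,E}=\mathrm{Id}\cup\{(w_1w_2,\,w_1c\pi_V(w_2)):c\in E\}$, $\ BSI_2=\mathrm{Id}\cup\{(w_1cw_2,\,w_1c\pi_V(w_2)):c\in C\}$; * $FCI_{1,E}=\mathrm{Id}\cup\{(w_1vw_2,\,w_1cv\pi_V(w_2)):c\in E,v\in V'\}$, $\ FCI_2=\mathrm{Id}\cup\{(w_1c\delta vw_2,\,w_1cv\pi_V(w_2)):c\in C',\delta\in N'^*,v\in V'\}$. All these relations, the projections $\pi_B$, and the compositions "first $\mathcal O_{ld}$ or $ins_E$, then $\pi_{\overline N}$" are rational. All of them except the function $l\text{-}del$ (for which only rationality is claimed) are realized by explicit transducers with at most three states; those of the two compositions arise from the transducers of $\mathcal O_{ld}$, $ins_E$ over $V\cup C$ by adding loops $n|\varepsilon$, $n\in N$, on all states. For every language $L\subseteq A^*$: * $SR\iff\pi_{\overline C}(L)\subseteq L$; $\ R\iff\pi_V(L)\subseteq\pi_{\overline N}(L)$; * $SD\iff l\text{-}del(L)\subseteq L\iff\mathcal O_{ld}(L)\subseteq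 L\iff\mathcal O_{del}(L)\subseteq L$; $\ D\iff\pi_{\overline N}(\mathcal O_{ld}(L))\subseteq\pi_{\overline N}(L)$; * $BSD\iff BSD_1(L)\subseteq BSD_2(L)$; $\ FCD\iff FCD_1(L)\subseteq FCD_2(L)$; * $SI\iff ins_C(L)\subseteq L$; $\ I\iff\pi_{\overline N}(ins_C(L))\subseteq\pi_{\overline N}(L)$; * $BSI\iff BSI_{1,C}(L)\subseteq BSI_2(L)$; $\ FCI\iff FCI_{1,C'}(L)\subseteq FCI_2(L)$; * $SIA^X\iff\bigcup_{c\in C}(ins_{\{c\}}(L)\cap\mathcal O_c^X(L))\subseteq L$; * $IA^X\iff\bigcup_{c\in C}\pi_{\overline N}\big(ins_{\{c\}}(L)\cap\mathcal O_c^X(L)\big)\subseteq\pi_{\overline N}(L)$; * $BSIA^X\iff\bigcup_{c\in C}(BSI_{1,\{c\}}(L)\cap\mathcal O_c^X(L))\subseteq BSI_2(L)$; * $FCIA^X\iff\bigcup_{c\in C'}(FCI_{1,\{c\}}(L)\cap\mathcal O_c^X(L))\subseteq FCI_2(L)$. -/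

import Mathlib

namespace InfoFlow

universe u

/-! ### Transducers, rational relations and observations -/

/-- A finite transducer from `A*` to `B*` with state set `Q`: a finite set of transitions
`q --(x|y)--> q'` with `x ∈ A*`, `y ∈ B*`, together with initial and final states. -/
structure Transducer (A B Q : Type*) where
  init : Set Q
  trans : Set (Q × (List A × List B) × Q)
  finite_trans : trans.Finite
  final : Set Q

namespace Transducer

variable {A B Q : Type*}

/-- `T.Path q u v q'`: there is a path from `q` to `q'` whose label is `u|v`. -/
inductive Path (T : Transducer A B Q) : Q → List A → List B → Q → Prop
  | nil (q : Q) : Path T q [] [] q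
  | cons {q q' q'' : Q} {x : List A} {y : List B} {u : List A} {v : List B} :
      (q, (x, y), q') ∈ T.trans → Path T q' u v q'' → Path T q (x ++ u) (y ++ v) q''

/-- The relation realized by a transducer: the labels of its accepting paths. -/
def rel (T : Transducer A B Q) : SetRel (List A) (List B) :=
  {p | ∃ q ∈ T.init, ∃ q' ∈ T.final, T.Path q p.1 p.2 q'}

end Transducer

/-- A relation between words is rational if a finite transducer realizes it. -/
def IsRational {A B : Type*} (R : SetRel (List A) (List B)) : Prop :=
  ∃ (Q : Type) (_ : Finite Q) (T : Transducer A B Q), T.rel = R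

/-- The observation `O(L) = ⋃ w ∈ L, O(w)` of a language. -/
def observe {A B : Type*} (O : SetRel (List A) (List B)) (L : Language A) : Language B :=
  {v : List B | ∃ u ∈ L, (u, v) ∈ O}

/-! ### Rational information flow properties -/

/-- The grammar `E ::= L | O(E) | E ∪ E | E ∩ E` with `O` ranging over rational observers;
`RatExpr A B` consists of the expressions that denote a language over the alphabet `B` when the
variable `L` is a language over `A`. -/
inductive RatExpr (A : Type u) : Type u → Type (u + 1)
  | lang : RatExpr A A
  | obs {B D : Type u} [Finite B] [Finite D] (O : SetRel (List B) (List D))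
      (hO : IsRational O) (e : RatExpr A B) : RatExpr A D
  | union {B : Type u} (e₁ e₂ : RatExpr A B) : RatExpr A B
  | inter {B : Type u} (e₁ e₂ : RatExpr A B) : RatExpr A B

/-- The language denoted by an expression. -/
def RatExpr.eval {A : Type u} (L : Language A) : {B : Type u} → RatExpr A B → Language B
  | _, .lang => L
  | _, @RatExpr.obs _ _ _ _ _ O _ e => observe O (e.eval L)
  | _, .union e₁ e₂ => e₁.eval L ⊔ e₂.eval L
  | _, .inter e₁ e₂ => e₁.eval L ⊓ e₂.eval L

/-- `RIF 𝓛`: the properties of languages in the family `𝓛` that are given by an inclusion between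
two fixed expressions. -/
def RIF {A : Type u} (𝓛 : Set (Language A)) : Set (Language A → Prop) :=
  {φ | ∃ (B : Type u) (_ : Finite B) (e₁ e₂ : RatExpr A B),
    ∀ L ∈ 𝓛, (φ L ↔ e₁.eval L ≤ e₂.eval L)}

/-! ### Basic security predicates -/

open Classical in
/-- The projection `π_B`, which erases the letters outside `B`. -/
noncomputable def proj {A : Type*} (B : Set A) (w : List A) : List A :=
  w.filter (fun a => a ∈ B)

/-- A partition of the alphabet into visible (`V`), confidential (`C`) and internal (`N`)
events. -/
structure View (A : Type*) where
  V : Set A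
  C : Set A
  N : Set A
  disjoint_V_C : Disjoint V C
  disjoint_V_N : Disjoint V N
  disjoint_C_N : Disjoint C N
  cover : V ∪ C ∪ N = Set.univ

namespace View

variable {A : Type*} (P : View A)

/-- Words that agree up to internal events. -/
def SimN (w w' : List A) : Prop := proj P.Nᶜ w = proj P.Nᶜ w'

/-- Strict removal. -/
def SR (L : Language A) : Prop := ∀ w ∈ L, proj P.Cᶜ w ∈ L

/-- Removal. -/
def R (L : Language A) : Prop :=
  ∀ w ∈ L, ∃ w' ∈ L, proj P.C w' = [] ∧ proj P.V w' = proj P.V w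

/-- Strict deletion. -/
def SD (L : Language A) : Prop :=
  ∀ w₁ w₂, ∀ c ∈ P.C, w₁ ++ c :: w₂ ∈ L → proj P.C w₂ = [] → w₁ ++ w₂ ∈ L

/-- Deletion. -/
def D (L : Language A) : Prop :=
  ∀ w₁ w₂, ∀ c ∈ P.C, w₁ ++ c :: w₂ ∈ L → proj P.C w₂ = [] →
    ∃ w₁' w₂', P.SimN w₁ w₁' ∧ P.SimN w₂ w₂' ∧ w₁' ++ w₂' ∈ L

/-- Backward strict deletion. -/
def BSD (L : Language A) : Prop :=
  ∀ w₁ w₂, ∀ c ∈ P.C, w₁ ++ c :: w₂ ∈ L → proj P.C w₂ = [] →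
    ∃ w₂', P.SimN w₂ w₂' ∧ w₁ ++ w₂' ∈ L

/-- Forward correctable deletion with respect to `V' ⊆ V`, `C' ⊆ C`, `N' ⊆ N`. -/
def FCD (V' C' N' : Set A) (L : Language A) : Prop :=
  ∀ w₁ w₂, ∀ c ∈ C', ∀ v ∈ V', w₁ ++ c :: v :: w₂ ∈ L → proj P.C w₂ = [] →
    ∃ δ w₂', (∀ n ∈ δ, n ∈ N') ∧ P.SimN w₂ w₂' ∧ w₁ ++ δ ++ v :: w₂' ∈ L

/-- Strict insertion. -/
def SI (L : Language A) : Prop :=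
  ∀ w₁ w₂, w₁ ++ w₂ ∈ L → proj P.C w₂ = [] → ∀ c ∈ P.C, w₁ ++ c :: w₂ ∈ L

/-- Insertion. -/
def I (L : Language A) : Prop :=
  ∀ w₁ w₂, w₁ ++ w₂ ∈ L → proj P.C w₂ = [] → ∀ c ∈ P.C,
    ∃ w₁' w₂', P.SimN w₁ w₁' ∧ P.SimN w₂ w₂' ∧ w₁' ++ c :: w₂' ∈ L

/-- Backward strict insertion. -/
def BSI (L : Language A) : Prop :=
  ∀ w₁ w₂, w₁ ++ w₂ ∈ L → proj P.C w₂ = [] → ∀ c ∈ P.C,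
    ∃ w₂', P.SimN w₂ w₂' ∧ w₁ ++ c :: w₂' ∈ L

/-- Forward correctable insertion with respect to `V' ⊆ V`, `C' ⊆ C`, `N' ⊆ N`. -/
def FCI (V' C' N' : Set A) (L : Language A) : Prop :=
  ∀ w₁ w₂, ∀ v ∈ V', w₁ ++ v :: w₂ ∈ L → proj P.C w₂ = [] → ∀ c ∈ C',
    ∃ δ w₂', (∀ n ∈ δ, n ∈ N') ∧ P.SimN w₂ w₂' ∧ w₁ ++ c :: δ ++ v :: w₂' ∈ L

/-- After `w₁` the event `c` is `X`-admissible in `L`. -/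
def Adm (X : Set A) (c : A) (w₁ : List A) (L : Language A) : Prop :=
  ∃ w₃, w₃ ++ [c] ∈ L ∧ proj X w₁ = proj X w₃

/-- Strict insertion of `X`-admissible events. -/
def SIA (X : Set A) (L : Language A) : Prop :=
  ∀ w₁ w₂, w₁ ++ w₂ ∈ L → proj P.C w₂ = [] → ∀ c ∈ P.C, Adm X c w₁ L → w₁ ++ c :: w₂ ∈ L

/-- Insertion of `X`-admissible events. -/
def IA (X : Set A) (L : Language A) : Prop :=
  ∀ w₁ w₂, w₁ ++ w₂ ∈ L → proj P.C w₂ = [] → ∀ c ∈ P.C, Adm X c w₁ L →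
    ∃ w₁' w₂', P.SimN w₁ w₁' ∧ P.SimN w₂ w₂' ∧ w₁' ++ c :: w₂' ∈ L

/-- Backward strict insertion of `X`-admissible events. -/
def BSIA (X : Set A) (L : Language A) : Prop :=
  ∀ w₁ w₂, w₁ ++ w₂ ∈ L → proj P.C w₂ = [] → ∀ c ∈ P.C, Adm X c w₁ L →
    ∃ w₂', P.SimN w₂ w₂' ∧ w₁ ++ c :: w₂' ∈ L

/-- Forward correctable insertion of `X`-admissible events. -/
def FCIA (X V' C' N' : Set A) (L : Language A) : Prop :=
  ∀ w₁ w₂, ∀ v ∈ V', w₁ ++ v :: w₂ ∈ L → proj P.C w₂ = [] → ∀ c ∈ C', Adm X c w₁ L →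
    ∃ δ w₂', (∀ n ∈ δ, n ∈ N') ∧ P.SimN w₂ w₂' ∧ w₁ ++ c :: δ ++ v :: w₂' ∈ L

end View

/-- The fourteen basic security predicates, with their parameters. -/
inductive BSP {A : Type*} (P : View A)
  | SR | R | SD | D | BSD
  | FCD (V' C' N' : Set A) (hV : V' ⊆ P.V) (hC : C' ⊆ P.C) (hN : N' ⊆ P.N)
  | SI | I | BSI
  | FCI (V' C' N' : Set A) (hV : V' ⊆ P.V) (hC : C' ⊆ P.C) (hN : N' ⊆ P.N)
  | SIA (X : Set A) | IA (X : Set A) | BSIA (X : Set A)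
  | FCIA (X V' C' N' : Set A) (hV : V' ⊆ P.V) (hC : C' ⊆ P.C) (hN : N' ⊆ P.N)

/-- `b.Sat L`: the language `L` satisfies the basic security predicate `b`. -/
def BSP.Sat {A : Type*} {P : View A} : BSP P → Language A → Prop
  | .SR => P.SR
  | .R => P.R
  | .SD => P.SD
  | .D => P.D
  | .BSD => P.BSD
  | .FCD V' C' N' _ _ _ => P.FCD V' C' N'
  | .SI => P.SI
  | .I => P.I
  | .BSI => P.BSI
  | .FCI V' C' N' _ _ _ => P.FCI V' C' N'
  | .SIA X => P.SIA X
  | .IA X => P.IA X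
  | .BSIA X => P.BSIA X
  | .FCIA X V' C' N' _ _ _ => P.FCIA X V' C' N'

/-! ### The observers, as relations -/

/-- The projection `π_B` as an observer. -/
def projObs {A : Type*} (B : Set A) : SetRel (List A) (List A) := {(u, v) | v = proj B u}

open Classical in
/-- `l-del`: delete the last letter of `w` that belongs to `C` (if there is one). -/
noncomputable def delLast {A : Type*} (C : Set A) (w : List A) : List A :=
  (w.reverse.eraseP (fun a => a ∈ C)).reverse

namespace View

variable {A : Type*} (P : View A)

/-- Leave the word as it is or delete its last confidential event. -/
def lDelObs : SetRel (List A) (List A) := {(u, v) | v = u ∨ v = delLast P.C u}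

/-- The closure of `l-del` under composition: `⋃ k, l-del ^ k`. -/
def delObs : SetRel (List A) (List A) := {(u, v) | ∃ k : ℕ, v = (delLast P.C)^[k] u}

/-- Leave the word as it is or insert a letter of `E` after all confidential events. -/
def insObs (E : Set A) : SetRel (List A) (List A) :=
  {(u, v) | v = u ∨ ∃ w₁ w₂, ∃ c ∈ E, proj P.C w₂ = [] ∧ u = w₁ ++ w₂ ∧ v = w₁ ++ c :: w₂}

/-- `u ↦ π_X⁻¹(π_X(c⁻¹u)) · c · (V ∪ N)*`, where `c⁻¹u = {u₁ | u₁c = u}`. -/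
def admObs (X : Set A) (c : A) : SetRel (List A) (List A) :=
  {(u, v) | ∃ u₁ v₁ v₂, u = u₁ ++ [c] ∧ proj X v₁ = proj X u₁ ∧ (∀ a ∈ v₂, a ∈ P.V ∪ P.N) ∧
    v = v₁ ++ c :: v₂}

/-- The word `w₁ # π_V(w₂)` over `A ∪ {#}`; the fresh letter `#` is `none`. -/
noncomputable def marked (w₁ w₂ : List A) : List (Option A) :=
  w₁.map some ++ none :: (proj P.V w₂).map some

/-- `w₁ c w₂ ↦ w₁ # π_V(w₂)`, and the identity. -/
def bsdObs₁ : SetRel (List A) (List (Option A)) :=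
  {(u, v) | v = u.map some ∨
    ∃ w₁ w₂, ∃ c ∈ P.C, proj P.C w₂ = [] ∧ u = w₁ ++ c :: w₂ ∧ v = P.marked w₁ w₂}

/-- `w₁ w₂ ↦ w₁ # π_V(w₂)`, and the identity. -/
def bsdObs₂ : SetRel (List A) (List (Option A)) :=
  {(u, v) | v = u.map some ∨
    ∃ w₁ w₂, proj P.C w₂ = [] ∧ u = w₁ ++ w₂ ∧ v = P.marked w₁ w₂}

/-- `w₁ c v w₂ ↦ w₁ # v π_V(w₂)`, and the identity. -/
def fcdObs₁ (V' C' : Set A) : SetRel (List A) (List (Option A)) :=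
  {(u, z) | z = u.map some ∨ ∃ w₁ w₂, ∃ c ∈ C', ∃ v ∈ V', proj P.C w₂ = [] ∧
    u = w₁ ++ c :: v :: w₂ ∧ z = P.marked w₁ (v :: w₂)}

/-- `w₁ δ v w₂ ↦ w₁ # v π_V(w₂)` for `δ ∈ N'*`, and the identity. -/
def fcdObs₂ (V' N' : Set A) : SetRel (List A) (List (Option A)) :=
  {(u, z) | z = u.map some ∨ ∃ w₁ δ w₂, ∃ v ∈ V', (∀ n ∈ δ, n ∈ N') ∧ proj P.C w₂ = [] ∧
    u = w₁ ++ δ ++ v :: w₂ ∧ z = P.marked w₁ (v :: w₂)}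

/-- `w₁ w₂ ↦ w₁ c π_V(w₂)` for `c ∈ E`, and the identity. -/
def bsiObs₁ (E : Set A) : SetRel (List A) (List A) :=
  {(u, z) | z = u ∨ ∃ w₁ w₂, ∃ c ∈ E, proj P.C w₂ = [] ∧
    u = w₁ ++ w₂ ∧ z = w₁ ++ c :: proj P.V w₂}

/-- `w₁ c w₂ ↦ w₁ c π_V(w₂)` for `c ∈ C`, and the identity. -/
def bsiObs₂ : SetRel (List A) (List A) :=
  {(u, z) | z = u ∨ ∃ w₁ w₂, ∃ c ∈ P.C, proj P.C w₂ = [] ∧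
    u = w₁ ++ c :: w₂ ∧ z = w₁ ++ c :: proj P.V w₂}

/-- `w₁ v w₂ ↦ w₁ c v π_V(w₂)` for `c ∈ E`, `v ∈ V'`, and the identity. -/
def fciObs₁ (V' E : Set A) : SetRel (List A) (List A) :=
  {(u, z) | z = u ∨ ∃ w₁ w₂, ∃ c ∈ E, ∃ v ∈ V', proj P.C w₂ = [] ∧
    u = w₁ ++ v :: w₂ ∧ z = w₁ ++ c :: v :: proj P.V w₂}

/-- `w₁ c δ v w₂ ↦ w₁ c v π_V(w₂)` for `c ∈ C'`, `v ∈ V'`, `δ ∈ N'*`, and the identity. -/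
def fciObs₂ (V' C' N' : Set A) : SetRel (List A) (List A) :=
  {(u, z) | z = u ∨ ∃ w₁ δ w₂, ∃ c ∈ C', ∃ v ∈ V', (∀ n ∈ δ, n ∈ N') ∧ proj P.C w₂ = [] ∧
    u = w₁ ++ c :: δ ++ v :: w₂ ∧ z = w₁ ++ c :: v :: proj P.V w₂}

end View

/-! ### The explicit transducers -/

/-- The transitions `q --(x a | y a)--> q'` for `a ∈ S`. -/
def arcs {A B Q : Type*} (q q' : Q) (S : Set A) (x : A → List A) (y : A → List B) :
    Set (Q × (List A × List B) × Q) :=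
  (fun a => (q, (x a, y a), q')) '' S

/-- `a|a` for `a ∈ S`. -/
def copy {A Q : Type*} (q q' : Q) (S : Set A) : Set (Q × (List A × List A) × Q) :=
  arcs q q' S (fun a => [a]) (fun a => [a])

/-- `a|a` for `a ∈ S`, with output alphabet `A ∪ {#}`. -/
def copyM {A Q : Type*} (q q' : Q) (S : Set A) : Set (Q × (List A × List (Option A)) × Q) :=
  arcs q q' S (fun a => [a]) (fun a => [some a])

/-- `a|ε` for `a ∈ S`. -/
def erase {A B Q : Type*} (q q' : Q) (S : Set A) : Set (Q × (List A × List B) × Q) :=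
  arcs q q' S (fun a => [a]) (fun _ => [])

/-- `ε|a` for `a ∈ S`. -/
def emit {A Q : Type*} (q q' : Q) (S : Set A) : Set (Q × (List A × List A) × Q) :=
  arcs q q' S (fun _ => []) (fun a => [a])

instance {A B Q : Type*} [Finite A] (q q' : Q) (S : Set A) (x : A → List A) (y : A → List B) :
    Finite (arcs q q' S x y) := by unfold arcs; infer_instance

instance {A Q : Type*} [Finite A] (q q' : Q) (S : Set A) : Finite (copy q q' S) := by
  unfold copy; infer_instance

instance {A Q : Type*} [Finite A] (q q' : Q) (S : Set A) : Finite (copyM q q' S) := by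
  unfold copyM; infer_instance

instance {A B Q : Type*} [Finite A] (q q' : Q) (S : Set A) :
    Finite (erase (B := B) q q' S) := by
  unfold erase; infer_instance

instance {A Q : Type*} [Finite A] (q q' : Q) (S : Set A) : Finite (emit q q' S) := by
  unfold emit; infer_instance

/-- Add a loop `n|ε` on every state, for every `n ∈ N`. -/
def Transducer.ignoring {A B Q : Type*} [Finite A] [Finite Q] (T : Transducer A B Q)
    (N : Set A) : Transducer A B Q where
  init := T.init
  trans := T.trans ∪ ⋃ q, erase q q N
  finite_trans := T.finite_trans.union (Set.toFinite _)
  final := T.final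

section Explicit

variable {A : Type*} [Finite A]

/-- Transducer for `π_B`. -/
def projT (B : Set A) : Transducer A A (Fin 1) where
  init := {0}
  trans := copy 0 0 B ∪ erase 0 0 Bᶜ
  finite_trans := Set.toFinite _
  final := {0}

namespace View

variable (P : View A)

/-- Deletion of the last confidential event, for words over the subalphabet `S`. -/
def lDelT (S : Set A) : Transducer A A (Fin 2) where
  init := {0}
  trans := copy 0 0 S ∪ erase 0 1 P.C ∪ copy 1 1 (S \ P.C)
  finite_trans := Set.toFinite _
  final := {0, 1}

/-- Iterated deletion of the last confidential event. -/
def delT : Transducer A A (Fin 2) where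
  init := {0}
  trans := copy 0 0 Set.univ ∪ erase 0 1 P.C ∪ copy 1 1 (P.V ∪ P.N) ∪ erase 1 1 P.C
  finite_trans := Set.toFinite _
  final := {0, 1}

/-- Insertion of a letter of `E`, for words over the subalphabet `S`. -/
def insT (S E : Set A) : Transducer A A (Fin 2) where
  init := {0}
  trans := copy 0 0 S ∪ emit 0 1 E ∪ copy 1 1 (S \ P.C)
  finite_trans := Set.toFinite _
  final := {0, 1}

/-- Transducer for `admObs`. -/
def admT (X : Set A) (c : A) : Transducer A A (Fin 2) where
  init := {0}
  trans := copy 0 0 X ∪ erase 0 0 Xᶜ ∪ emit 0 0 Xᶜ ∪ copy 0 1 {c} ∪ emit 1 1 (P.V ∪ P.N)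
  finite_trans := Set.toFinite _
  final := {1}

/-- Transducer for `bsdObs₁`. -/
def bsdT₁ : Transducer A (Option A) (Fin 2) where
  init := {0}
  trans := copyM 0 0 Set.univ ∪ arcs 0 1 P.C (fun c => [c]) (fun _ => [none]) ∪
    copyM 1 1 P.V ∪ erase 1 1 P.N
  finite_trans := Set.toFinite _
  final := {0, 1}

/-- Transducer for `bsdObs₂`. -/
def bsdT₂ : Transducer A (Option A) (Fin 2) where
  init := {0}
  trans := copyM 0 0 Set.univ ∪ {(0, ([], [none]), 1)} ∪ copyM 1 1 P.V ∪ erase 1 1 P.N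
  finite_trans := Set.toFinite _
  final := {0, 1}

/-- Transducer for `fcdObs₁`. -/
def fcdT₁ (V' C' : Set A) : Transducer A (Option A) (Fin 3) where
  init := {0}
  trans := copyM 0 0 Set.univ ∪ arcs 0 1 C' (fun c => [c]) (fun _ => [none]) ∪
    copyM 1 2 V' ∪ copyM 2 2 P.V ∪ erase 2 2 P.N
  finite_trans := Set.toFinite _
  final := {0, 2}

/-- Transducer for `fcdObs₂`. -/
def fcdT₂ (V' N' : Set A) : Transducer A (Option A) (Fin 3) where
  init := {0}
  trans := copyM 0 0 Set.univ ∪ {(0, ([], [none]), 1)} ∪ erase 1 1 N' ∪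
    copyM 1 2 V' ∪ copyM 2 2 P.V ∪ erase 2 2 P.N
  finite_trans := Set.toFinite _
  final := {0, 2}

/-- Transducer for `bsiObs₁`. -/
def bsiT₁ (E : Set A) : Transducer A A (Fin 2) where
  init := {0}
  trans := copy 0 0 Set.univ ∪ emit 0 1 E ∪ copy 1 1 P.V ∪ erase 1 1 P.N
  finite_trans := Set.toFinite _
  final := {0, 1}

/-- Transducer for `bsiObs₂`. -/
def bsiT₂ : Transducer A A (Fin 2) where
  init := {0}
  trans := copy 0 0 Set.univ ∪ copy 0 1 P.C ∪ copy 1 1 P.V ∪ erase 1 1 P.N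
  finite_trans := Set.toFinite _
  final := {0, 1}

/-- Transducer for `fciObs₁`. -/
def fciT₁ (V' E : Set A) : Transducer A A (Fin 3) where
  init := {0}
  trans := copy 0 0 Set.univ ∪ emit 0 1 E ∪ copy 1 2 V' ∪ copy 2 2 P.V ∪ erase 2 2 P.N
  finite_trans := Set.toFinite _
  final := {0, 2}

/-- Transducer for `fciObs₂`. -/
def fciT₂ (V' C' N' : Set A) : Transducer A A (Fin 3) where
  init := {0}
  trans := copy 0 0 Set.univ ∪ copy 0 1 C' ∪ erase 1 1 N' ∪ copy 1 2 V' ∪ copy 2 2 P.V ∪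
    erase 2 2 P.N
  finite_trans := Set.toFinite _
  final := {0, 2}

end View

end Explicit

end InfoFlow

open InfoFlow

/-! Apart from `SR` and `R`, which are inclusions between projections, each predicate concerns a
factorization of a word of `L` whose right factor `w₂` contains no confidential letter. A finite
transducer can guess the cut and verify it, by having no transition that copies or skips a letter of
`C` afterwards. The left observer then outputs a code of the word that the predicate demands, and
the right observer outputs the codes of the acceptable witnesses found in `L`; the predicate says
that every demanded code occurs.

The code has to determine the cut and the tail up to `∼`. On words without confidential letters `∼`
is equality of visible projections (`View.simN_of_proj_V`), so `π_V(w₂)` encodes the tail. In the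
insertion predicates the inserted `c` is the last confidential letter of the code and thus marks the
cut (`eq_of_append_cons_eq`); in `BSD` and `FCD` it has been deleted, and the fresh letter `#` takes
its place (`View.marked_inj`). In `D` and `I`, where `w₁` also matters only up to `∼`, both sides
are projected to `V ∪ C`, and the factorization is lifted back through the projection
(`View.exists_simN_append`, `View.exists_simN_append_cons`). The identity branches of the observers
are harmless: they give words already matched on the right, or words without `#`, or a witness
themselves. Admissibility depends only on `c` and `w₁`, so it is imposed by intersecting with an
observer that leaves the tail after `c` free (`View.append_cons_mem_observe_admObs`); the union over
`c` is finite, hence an expression.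

Rationality is proved transducer by transducer. Soundness assigns to each state a relation bounding
what can still be read and written from there (`Transducer.rel_subset`); completeness concatenates
loops and single transitions. -/

namespace InfoFlow

/-! ### Projections -/

section Proj

variable {A : Type*} {B S : Set A} {a : A} {w w₁ w₂ : List A}

@[simp] theorem proj_nil : proj B [] = [] := rfl

theorem proj_cons_of_mem (h : a ∈ B) : proj B (a :: w) = a :: proj B w := by
  simp [proj, h]

theorem proj_cons_of_notMem (h : a ∉ B) : proj B (a :: w) = proj B w := by
  simp [proj, h]

@[simp] theorem proj_append : proj B (w₁ ++ w₂) = proj B w₁ ++ proj B w₂ := by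
  simp [proj]

theorem mem_proj : a ∈ proj B w ↔ a ∈ w ∧ a ∈ B := by simp [proj]

theorem proj_eq_nil_iff : proj B w = [] ↔ ∀ a ∈ w, a ∉ B := by simp [proj]

theorem proj_eq_self_iff : proj B w = w ↔ ∀ a ∈ w, a ∈ B := by simp [proj]

theorem proj_compl_of_proj_eq_nil (h : proj B w = []) : proj Bᶜ w = w :=
  proj_eq_self_iff.2 (proj_eq_nil_iff.1 h)

theorem proj_congr (h : ∀ a ∈ w, (a ∈ B ↔ a ∈ S)) : proj B w = proj S w := by
  classical exact List.filter_congr fun a ha => by simpa using h a ha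

theorem proj_proj : proj S (proj B w) = proj (S ∩ B) w := by
  classical simp [proj, List.filter_filter]

theorem proj_eq_append_iff :
    proj B w = w₁ ++ w₂ ↔ ∃ u₁ u₂, w = u₁ ++ u₂ ∧ proj B u₁ = w₁ ∧ proj B u₂ = w₂ :=
  List.filter_eq_append_iff

theorem exists_of_proj_eq_cons (h : proj B w = a :: w₂) :
    ∃ u₁ u₂, w = u₁ ++ a :: u₂ ∧ proj B u₁ = [] ∧ proj B u₂ = w₂ := by
  obtain ⟨u₁, u₂, h₁, h₂, -, h₃⟩ := List.filter_eq_cons_iff.1 h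
  exact ⟨u₁, u₂, h₁, proj_eq_nil_iff.2 (by simpa using h₂), h₃⟩

/-- A word has a last letter in `B`, unless its projection is empty. -/
theorem proj_eq_nil_or_exists_last (B : Set A) (w : List A) :
    proj B w = [] ∨ ∃ w₁ w₂, ∃ b ∈ B, proj B w₂ = [] ∧ w = w₁ ++ b :: w₂ := by
  induction w with
  | nil => simp
  | cons a w ih =>
    rcases ih with ih | ⟨w₁, w₂, b, hb, h, rfl⟩
    · by_cases ha : a ∈ B
      · exact .inr ⟨[], w, a, ha, ih, rfl⟩
      · exact .inl (by rw [proj_cons_of_notMem ha, ih])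
    · exact .inr ⟨a :: w₁, w₂, b, hb, h, rfl⟩

/-- The last letter in `B` determines the factorization of the word. -/
theorem eq_of_append_cons_eq {u₁ u₂ : List A} {b : A} (ha : a ∈ B) (hb : b ∈ B)
    (hw : proj B w₂ = []) (hu : proj B u₂ = []) (h : w₁ ++ a :: w₂ = u₁ ++ b :: u₂) :
    w₁ = u₁ ∧ a = b ∧ w₂ = u₂ := by
  rw [proj_eq_nil_iff] at hw hu
  rw [List.append_eq_append_iff] at h
  rcases h with ⟨as, rfl, h⟩ | ⟨bs, rfl, h⟩
  · cases as with
    | nil => simpa using h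
    | cons x as =>
      simp only [List.cons_append, List.cons.injEq] at h
      exact absurd hb (hw b (by simp [h.2]))
  · cases bs with
    | nil => simpa [eq_comm] using h
    | cons x as =>
      simp only [List.cons_append, List.cons.injEq] at h
      exact absurd ha (hu a (by simp [h.2]))

theorem delLast_of_proj_eq_nil (h : proj B w = []) : delLast B w = w := by
  classical
  rw [proj_eq_nil_iff] at h
  rw [delLast, List.eraseP_of_forall_not (by simpa using h), List.reverse_reverse]

theorem delLast_append_cons (ha : a ∈ B) (h : proj B w₂ = []) :
    delLast B (w₁ ++ a :: w₂) = w₁ ++ w₂ := by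
  classical
  rw [proj_eq_nil_iff] at h
  rw [delLast, List.reverse_append, List.reverse_cons, List.append_assoc,
    List.eraseP_append_right _ (by simpa using h)]
  simp [ha]

end Proj

/-! ### Visible, confidential and internal letters; the relation `∼`. -/

namespace View

variable {A : Type*} (P : View A) {a : A} {w w₁ w₂ u : List A}

theorem mem_cases (a : A) : a ∈ P.V ∨ a ∈ P.C ∨ a ∈ P.N := by
  have := P.cover.ge (Set.mem_univ a)
  simpa [or_assoc] using this

theorem notMem_C_of_mem_V (h : a ∈ P.V) : a ∉ P.C := P.disjoint_V_C.notMem_of_mem_left h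

theorem notMem_N_of_mem_V (h : a ∈ P.V) : a ∉ P.N := P.disjoint_V_N.notMem_of_mem_left h

theorem notMem_N_of_mem_C (h : a ∈ P.C) : a ∉ P.N := P.disjoint_C_N.notMem_of_mem_left h

theorem mem_V_or_mem_N_iff : a ∈ P.V ∨ a ∈ P.N ↔ a ∉ P.C := by
  have := P.mem_cases a
  have := P.notMem_C_of_mem_V (a := a)
  have := P.notMem_N_of_mem_C (a := a)
  tauto

theorem mem_N_of_notMem (hC : a ∉ P.C) (hV : a ∉ P.V) : a ∈ P.N := by
  have := P.mem_cases a
  tauto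

theorem proj_compl_N_of_proj_C (h : proj P.C w = []) : proj P.Nᶜ w = proj P.V w :=
  proj_congr fun a ha => by
    have := proj_eq_nil_iff.1 h a ha
    have := P.mem_N_of_notMem (a := a) this
    have := P.notMem_N_of_mem_V (a := a)
    rw [Set.mem_compl_iff]
    tauto

theorem proj_C_proj_compl_N : proj P.C (proj P.Nᶜ w) = proj P.C w := by
  rw [proj_proj]
  congr 1
  exact Set.inter_eq_left.2 fun a => P.notMem_N_of_mem_C

theorem proj_V_proj_compl_N : proj P.V (proj P.Nᶜ w) = proj P.V w := by
  rw [proj_proj]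
  congr 1
  exact Set.inter_eq_left.2 fun a => P.notMem_N_of_mem_V

variable {P}

theorem SimN.proj_C (h : P.SimN w u) : proj P.C w = proj P.C u := by
  rw [← P.proj_C_proj_compl_N, show proj _ w = _ from h, proj_C_proj_compl_N]

theorem SimN.proj_V (h : P.SimN w u) : proj P.V w = proj P.V u := by
  rw [← P.proj_V_proj_compl_N, show proj _ w = _ from h, proj_V_proj_compl_N]

/-- Once confidential letters are excluded, the letters outside `N` are exactly the visible ones.
This is what allows an observer to output `π_V(w₂)` in place of the whole `∼`-class of `w₂`. -/
theorem simN_of_proj_V (hw : proj P.C w = []) (hu : proj P.C u = [])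
    (h : proj P.V w = proj P.V u) : P.SimN w u := by
  rw [SimN, P.proj_compl_N_of_proj_C hw, P.proj_compl_N_of_proj_C hu, h]

variable (P) in
theorem proj_C_proj_V : proj P.C (proj P.V w) = [] :=
  proj_eq_nil_iff.2 fun _ h => P.notMem_C_of_mem_V (mem_proj.1 h).2

theorem simN_proj_V (hw : proj P.C w = []) : P.SimN w (proj P.V w) :=
  simN_of_proj_V hw P.proj_C_proj_V (by rw [proj_proj, Set.inter_self])

end View

/-! ### Transducers -/

section Arcs

variable {A B Q : Type*} {q q' r r' : Q} {S : Set A} {x : List A}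

@[simp] theorem mem_arcs {f : A → List A} {g : A → List B} {y : List B} :
    (r, (x, y), r') ∈ arcs q q' S f g ↔ r = q ∧ r' = q' ∧ ∃ a ∈ S, x = f a ∧ y = g a := by
  simp only [arcs, Set.mem_image, Prod.mk.injEq]
  grind

@[simp] theorem mem_copy {y : List A} :
    (r, (x, y), r') ∈ copy q q' S ↔ r = q ∧ r' = q' ∧ ∃ a ∈ S, x = [a] ∧ y = [a] :=
  mem_arcs

@[simp] theorem mem_copyM {y : List (Option A)} :
    (r, (x, y), r') ∈ copyM q q' S ↔ r = q ∧ r' = q' ∧ ∃ a ∈ S, x = [a] ∧ y = [some a] :=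
  mem_arcs

@[simp] theorem mem_erase {y : List B} :
    (r, (x, y), r') ∈ erase q q' S ↔ r = q ∧ r' = q' ∧ ∃ a ∈ S, x = [a] ∧ y = [] :=
  mem_arcs

@[simp] theorem mem_emit {y : List A} :
    (r, (x, y), r') ∈ emit q q' S ↔ r = q ∧ r' = q' ∧ ∃ a ∈ S, x = [] ∧ y = [a] :=
  mem_arcs

end Arcs

/-! ### Building paths from loops, and bounding the realized relation. -/

namespace Transducer

variable {A B Q : Type*} {T : Transducer A B Q} {q q' q'' : Q} {u u' : List A} {v v' : List B}

theorem Path.append (h : T.Path q u v q') (h' : T.Path q' u' v' q'') :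
    T.Path q (u ++ u') (v ++ v') q'' := by
  induction h with
  | nil => exact h'
  | cons ht _ ih => simpa only [List.append_assoc] using Path.cons ht (ih h')

theorem Path.loop_map {f : A → B} (h : ∀ a ∈ u, (q, ([a], [f a]), q) ∈ T.trans) :
    T.Path q u (u.map f) q := by
  induction u with
  | nil => exact .nil q
  | cons a u ih =>
    exact .cons (h a (by simp)) (ih fun b hb => h b (by simp [hb]))

theorem Path.loop_copy {T : Transducer A A Q} (h : ∀ a ∈ u, (q, ([a], [a]), q) ∈ T.trans) :
    T.Path q u u q := by
  simpa using Path.loop_map (f := id) h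

theorem Path.loop_erase (h : ∀ a ∈ u, (q, ([a], []), q) ∈ T.trans) : T.Path q u [] q := by
  induction u with
  | nil => exact .nil q
  | cons a u ih =>
    exact .cons (h a (by simp)) (ih fun b hb => h b (by simp [hb]))

theorem Path.loop_emit (h : ∀ b ∈ v, (q, ([], [b]), q) ∈ T.trans) : T.Path q [] v q := by
  induction v with
  | nil => exact .nil q
  | cons a v ih =>
    exact .cons (h a (by simp)) (ih fun b hb => h b (by simp [hb]))

/-- Transitions are required only for letters that occur in `u`, so that the lemma also serves
states with no transition for confidential letters, on words that contain none. -/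
theorem Path.loop_proj_map {f : A → B} {S : Set A}
    (h : ∀ a ∈ u, a ∈ S → (q, ([a], [f a]), q) ∈ T.trans)
    (h' : ∀ a ∈ u, a ∉ S → (q, ([a], []), q) ∈ T.trans) :
    T.Path q u ((proj S u).map f) q := by
  induction u with
  | nil => exact .nil q
  | cons a u ih =>
    have ih := ih (fun b hb => h b (by simp [hb])) (fun b hb => h' b (by simp [hb]))
    by_cases ha : a ∈ S
    · rw [proj_cons_of_mem ha]
      exact .cons (h a (by simp) ha) ih
    · rw [proj_cons_of_notMem ha]
      exact .cons (h' a (by simp) ha) ih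

theorem Path.loop_proj {T : Transducer A A Q} {S : Set A}
    (h : ∀ a ∈ u, a ∈ S → (q, ([a], [a]), q) ∈ T.trans)
    (h' : ∀ a ∈ u, a ∉ S → (q, ([a], []), q) ∈ T.trans) : T.Path q u (proj S u) q := by
  simpa using Path.loop_proj_map (f := id) h h'

/-- Soundness: `R q` bounds the labels of paths from `q` to a final state if it is closed under
prepending a transition. -/
theorem rel_subset {O : SetRel (List A) (List B)} (R : Q → List A → List B → Prop)
    (final : ∀ q ∈ T.final, R q [] [])
    (step : ∀ q x y q' u v, (q, (x, y), q') ∈ T.trans → R q' u v → R q (x ++ u) (y ++ v))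
    (init : ∀ q ∈ T.init, ∀ u v, R q u v → (u, v) ∈ O) : T.rel ⊆ O := by
  rintro ⟨u, v⟩ ⟨q, hq, q', hq', h⟩
  refine init q hq u v ?_
  clear hq
  dsimp only at h
  induction h with
  | nil q => exact final q hq'
  | cons ht _ ih => exact step _ _ _ _ _ _ ht (ih hq')

theorem mem_rel (hq : q ∈ T.init) (hq' : q' ∈ T.final) (h : T.Path q u v q') : (u, v) ∈ T.rel :=
  ⟨q, hq, q', hq', h⟩

end Transducer

/-! ### The explicit transducers realize the observers -/

open Transducer

theorem projObs_univ {A : Type*} : projObs (Set.univ : Set A) = SetRel.id := by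
  ext ⟨u, v⟩
  simp [projObs, proj, eq_comm]

/-- With nothing to ignore and the full alphabet as subalphabet, a statement about an observer
followed by a projection specializes to the observer alone. -/
theorem Transducer.ignoring_empty {A B Q : Type*} [Finite A] [Finite Q] (T : Transducer A B Q) :
    T.ignoring ∅ = T := by
  cases T
  simp [ignoring, erase, arcs]

theorem Transducer.mem_ignoring {A B Q : Type*} [Finite A] [Finite Q] {T : Transducer A B Q}
    {N : Set A} {q q' : Q} {x : List A} {y : List B} :
    (q, (x, y), q') ∈ (T.ignoring N).trans ↔
      (q, (x, y), q') ∈ T.trans ∨ q = q' ∧ ∃ a ∈ N, x = [a] ∧ y = [] := by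
  simp [ignoring, eq_comm]

theorem rel_projT {A : Type*} [Finite A] (B : Set A) : (projT B).rel = projObs B := by
  apply Set.Subset.antisymm
  · refine rel_subset (fun _ u v => v = proj B u) (by simp) ?_ (by simp [projObs])
    rintro _ x y _ u v h rfl
    simp only [projT, Set.mem_union, mem_copy, mem_erase] at h
    obtain ⟨-, -, a, ha, rfl, rfl⟩ | ⟨-, -, a, ha, rfl, rfl⟩ := h
    · exact (proj_cons_of_mem ha).symm
    · exact (proj_cons_of_notMem ha).symm
  · rintro ⟨u, v⟩ (rfl : v = _)
    exact mem_rel (q := 0) (q' := 0) rfl rfl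
      (Path.loop_proj (by simp [projT]) (by simp [projT]))

namespace View

/-! ### Explicit factorizations for the deletion observers. -/

section Relations

variable {A : Type*} (P : View A) {a : A} {w u v : List A}

theorem proj_C_cons_of_mem_V (h : a ∈ P.V) : proj P.C (a :: w) = proj P.C w :=
  proj_cons_of_notMem (P.notMem_C_of_mem_V h)

theorem proj_C_cons_of_mem_N (h : a ∈ P.N) : proj P.C (a :: w) = proj P.C w :=
  proj_cons_of_notMem fun h' => P.notMem_N_of_mem_C h' h

theorem proj_V_cons_of_mem_N (h : a ∈ P.N) : proj P.V (a :: w) = proj P.V w :=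
  proj_cons_of_notMem fun h' => P.notMem_N_of_mem_V h' h

theorem path_tail_map {B Q : Type*} {T : Transducer A B Q} {q : Q} {f : A → B}
    (hV : ∀ a ∈ P.V, (q, ([a], [f a]), q) ∈ T.trans)
    (hN : ∀ a ∈ P.N, (q, ([a], []), q) ∈ T.trans) (h : proj P.C w = []) :
    T.Path q w ((proj P.V w).map f) q :=
  Path.loop_proj_map (fun a _ => hV a) fun a ha hV =>
    hN a (P.mem_N_of_notMem (proj_eq_nil_iff.1 h a ha) hV)

theorem path_tail {Q : Type*} {T : Transducer A A Q} {q : Q}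
    (hV : ∀ a ∈ P.V, (q, ([a], [a]), q) ∈ T.trans)
    (hN : ∀ a ∈ P.N, (q, ([a], []), q) ∈ T.trans) (h : proj P.C w = []) :
    T.Path q w (proj P.V w) q := by
  simpa using P.path_tail_map (f := id) hV hN h

/-- If there is no confidential letter, `delLast` is the identity and falls under the first
alternative. The second is the form a transducer can guess. -/
theorem mem_lDelObs_iff : (u, v) ∈ P.lDelObs ↔
    v = u ∨ ∃ w₁ w₂, ∃ c ∈ P.C, proj P.C w₂ = [] ∧ u = w₁ ++ c :: w₂ ∧ v = w₁ ++ w₂ := by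
  constructor
  · rintro (rfl | rfl)
    · exact .inl rfl
    · obtain h | ⟨w₁, w₂, c, hc, h, rfl⟩ := proj_eq_nil_or_exists_last P.C u
      · exact .inl (delLast_of_proj_eq_nil h)
      · exact .inr ⟨w₁, w₂, c, hc, h, rfl, delLast_append_cons hc h⟩
  · rintro (rfl | ⟨w₁, w₂, c, hc, h, rfl, rfl⟩)
    · exact .inl rfl
    · exact .inr (delLast_append_cons hc h).symm

theorem exists_iterate_delLast (n : ℕ) : ∀ w₁ w₂ : List A, w₂.length ≤ n →
    ∃ k : ℕ, (delLast P.C)^[k] (w₁ ++ w₂) = w₁ ++ proj P.Cᶜ w₂ := by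
  induction n with
  | zero =>
    intro w₁ w₂ h
    exact ⟨0, by simp [List.length_eq_zero_iff.1 (Nat.le_zero.1 h)]⟩
  | succ n ih =>
    intro w₁ w₂ hn
    obtain h | ⟨a, b, c, hc, h, rfl⟩ := proj_eq_nil_or_exists_last P.C w₂
    · exact ⟨0, by simp [proj_compl_of_proj_eq_nil h]⟩
    -- One application removes the last confidential letter `c` of the right factor; the rest `a ++
    -- b` is shorter, and `w₁` has not been touched.
    · obtain ⟨k, hk⟩ := ih w₁ (a ++ b) (by simp at hn ⊢; lia)
      refine ⟨k + 1, ?_⟩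
      rw [Function.iterate_succ_apply, ← List.append_assoc, delLast_append_cons hc h,
        List.append_assoc, hk]
      simp [proj_cons_of_notMem, hc]

/-- Iteration deletes confidential letters from the right, so after some number of steps a suffix
has lost all of them and the prefix is intact. The letter `c` is the leftmost one deleted. -/
theorem mem_delObs_iff : (u, v) ∈ P.delObs ↔
    v = u ∨ ∃ w₁ w₂, ∃ c ∈ P.C, u = w₁ ++ c :: w₂ ∧ v = w₁ ++ proj P.Cᶜ w₂ := by
  constructor
  · rintro ⟨k, rfl⟩
    induction k with
    | zero => exact .inl rfl
    | succ k ih =>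
      rw [Function.iterate_succ_apply']
      generalize (delLast P.C)^[k] u = v at ih
      obtain rfl | ⟨w₁, w₂, c, hc, rfl, rfl⟩ := ih
      · obtain h | ⟨w₁, w₂, c, hc, h, rfl⟩ := proj_eq_nil_or_exists_last P.C v
        · exact .inl (delLast_of_proj_eq_nil h)
        · refine .inr ⟨w₁, w₂, c, hc, rfl, ?_⟩
          rw [delLast_append_cons hc h, proj_compl_of_proj_eq_nil h]
      -- The tail is already free of confidential letters, so a further deletion acts on the last
      -- one of `w₁`. That letter becomes the new cut, and the old `c` joins the tail that is
      -- projected.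
      · have hw₂ : proj P.C (proj P.Cᶜ w₂) = [] := by simp [proj_eq_nil_iff, mem_proj]
        obtain h | ⟨a, b, c', hc', h, rfl⟩ := proj_eq_nil_or_exists_last P.C w₁
        · exact .inr ⟨w₁, w₂, c, hc, rfl, delLast_of_proj_eq_nil (by simp [h, hw₂])⟩
        · refine .inr ⟨a, b ++ c :: w₂, c', hc', by simp, ?_⟩
          rw [List.append_assoc, List.cons_append, delLast_append_cons hc' (by simp [h, hw₂])]
          simp [proj_cons_of_notMem, hc, proj_compl_of_proj_eq_nil h]
  · rintro (rfl | ⟨w₁, w₂, c, hc, rfl, rfl⟩)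
    · exact ⟨0, rfl⟩
    · obtain ⟨k, hk⟩ := P.exists_iterate_delLast _ w₁ (c :: w₂) le_rfl
      exact ⟨k, by rw [hk, proj_cons_of_notMem (by simpa using hc)]⟩

end Relations

/-! ### Soundness and completeness of each transducer. -/

variable {A : Type*} [Finite A] (P : View A)

/-- Keeping `S` general treats two transducers at once: `S = univ` gives the plain observer and `S =
Nᶜ` its composition with the projection. -/
theorem rel_lDelT_ignoring {S : Set A} (hS : P.C ⊆ S) :
    ((P.lDelT S).ignoring Sᶜ).rel = P.lDelObs.comp (projObs S) := by
  apply Set.Subset.antisymm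
  -- State `0` may still delete. In state `1` the deletion is done, so the remaining input must be
  -- free of confidential letters and is merely projected.
  · refine rel_subset ![fun u v => ∃ w, (u, w) ∈ P.lDelObs ∧ v = proj S w,
      fun u v => proj P.C u = [] ∧ v = proj S u] ?_ ?_ (by simp [lDelT, ignoring, projObs])
    · simp [lDelT, ignoring, mem_lDelObs_iff]
    · simp only [mem_lDelObs_iff]
      intro q x y q' u v h hR
      simp only [mem_ignoring, lDelT, Set.mem_union, mem_copy, mem_erase] at h
      obtain ((⟨rfl, rfl, a, ha, rfl, rfl⟩ | ⟨rfl, rfl, a, ha, rfl, rfl⟩) |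
        ⟨rfl, rfl, a, ha, rfl, rfl⟩) | ⟨rfl, a, ha, rfl, rfl⟩ := h
      · obtain ⟨w, rfl | ⟨w₁, w₂, c, hc, h, rfl, rfl⟩, rfl⟩ := hR
        · exact ⟨a :: w, .inl rfl, (proj_cons_of_mem ha).symm⟩
        · exact ⟨a :: (w₁ ++ w₂), .inr ⟨a :: w₁, w₂, c, hc, h, rfl, rfl⟩,
            (proj_cons_of_mem ha).symm⟩
      · obtain ⟨h, rfl⟩ := hR
        exact ⟨u, .inr ⟨[], u, a, ha, h, rfl, rfl⟩, rfl⟩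
      · obtain ⟨h, rfl⟩ := hR
        exact ⟨(proj_cons_of_notMem ha.2).trans h, (proj_cons_of_mem ha.1).symm⟩
      -- Ignoring loops exist at both states. A skipped letter lies outside `S`, hence is not
      -- confidential, and the condition of state `1` survives it.
      · have haC : a ∉ P.C := fun h => ha (hS h)
        fin_cases q
        · obtain ⟨w, rfl | ⟨w₁, w₂, c, hc, h, rfl, rfl⟩, rfl⟩ := hR
          · exact ⟨a :: w, .inl rfl, (proj_cons_of_notMem ha).symm⟩
          · exact ⟨a :: (w₁ ++ w₂), .inr ⟨a :: w₁, w₂, c, hc, h, rfl, rfl⟩,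
              (proj_cons_of_notMem ha).symm⟩
        · obtain ⟨h, rfl⟩ := hR
          exact ⟨(proj_cons_of_notMem haC).trans h, (proj_cons_of_notMem ha).symm⟩
  · rintro ⟨u, v⟩ ⟨w, hw, rfl : v = _⟩
    have head (w) : ((P.lDelT S).ignoring Sᶜ).Path 0 w (proj S w) 0 :=
      Path.loop_proj (by simp [mem_ignoring, lDelT]) (by simp +contextual [mem_ignoring])
    obtain rfl | ⟨w₁, w₂, c, hc, h, rfl, rfl⟩ := P.mem_lDelObs_iff.1 hw
    · exact mem_rel (q := 0) (q' := 0) rfl (by simp [lDelT, ignoring]) (head _)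
    · refine mem_rel (q := 0) (q' := 1) rfl (by simp [lDelT, ignoring]) ?_
      rw [proj_append]
      refine (head w₁).append (.cons (x := [c]) (y := []) (q' := 1)
        (by simp [mem_ignoring, lDelT, hc]) (Path.loop_proj ?_ (by simp +contextual [mem_ignoring])))
      intro a ha haS
      simp [mem_ignoring, lDelT, haS, proj_eq_nil_iff.1 h a ha]

theorem rel_lDelT : (P.lDelT Set.univ).rel = P.lDelObs := by
  simpa [ignoring_empty, projObs_univ] using P.rel_lDelT_ignoring (Set.subset_univ _)

theorem rel_lDelT_ignoring_N :
    ((P.lDelT P.Nᶜ).ignoring P.N).rel = P.lDelObs.comp (projObs P.Nᶜ) := by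
  simpa using P.rel_lDelT_ignoring (S := P.Nᶜ) fun _ => P.notMem_N_of_mem_C

/-- As for deletion, one proof covers the plain and the projected observer. The hypothesis `E ⊆ S`
makes the inserted letter survive the projection. -/
theorem rel_insT_ignoring {S E : Set A} (hS : P.C ⊆ S) (hE : E ⊆ S) :
    ((P.insT S E).ignoring Sᶜ).rel = (P.insObs E).comp (projObs S) := by
  apply Set.Subset.antisymm
  · refine rel_subset ![fun u v => ∃ w, (u, w) ∈ P.insObs E ∧ v = proj S w,
      fun u v => proj P.C u = [] ∧ v = proj S u] ?_ ?_ (by simp [insT, ignoring, projObs])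
    · simp [insT, ignoring, insObs]
    · intro q x y q' u v h hR
      simp only [mem_ignoring, insT, Set.mem_union, mem_copy, mem_emit] at h
      obtain ((⟨rfl, rfl, a, ha, rfl, rfl⟩ | ⟨rfl, rfl, a, ha, rfl, rfl⟩) |
        ⟨rfl, rfl, a, ha, rfl, rfl⟩) | ⟨rfl, a, ha, rfl, rfl⟩ := h
      · obtain ⟨w, rfl | ⟨w₁, w₂, c, hc, h, rfl, rfl⟩, rfl⟩ := hR
        · exact ⟨a :: w, .inl rfl, (proj_cons_of_mem ha).symm⟩
        · exact ⟨a :: (w₁ ++ c :: w₂), .inr ⟨a :: w₁, w₂, c, hc, h, rfl, rfl⟩,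
            (proj_cons_of_mem ha).symm⟩
      · obtain ⟨h, rfl⟩ := hR
        exact ⟨a :: u, .inr ⟨[], u, a, ha, h, rfl, rfl⟩, (proj_cons_of_mem (hE ha)).symm⟩
      · obtain ⟨h, rfl⟩ := hR
        exact ⟨(proj_cons_of_notMem ha.2).trans h, (proj_cons_of_mem ha.1).symm⟩
      · have haC : a ∉ P.C := fun h => ha (hS h)
        fin_cases q
        · obtain ⟨w, rfl | ⟨w₁, w₂, c, hc, h, rfl, rfl⟩, rfl⟩ := hR
          · exact ⟨a :: w, .inl rfl, (proj_cons_of_notMem ha).symm⟩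
          · exact ⟨a :: (w₁ ++ c :: w₂), .inr ⟨a :: w₁, w₂, c, hc, h, rfl, rfl⟩,
              (proj_cons_of_notMem ha).symm⟩
        · obtain ⟨h, rfl⟩ := hR
          exact ⟨(proj_cons_of_notMem haC).trans h, (proj_cons_of_notMem ha).symm⟩
  · rintro ⟨u, v⟩ ⟨w, h, rfl : v = _⟩
    have head (w) : ((P.insT S E).ignoring Sᶜ).Path 0 w (proj S w) 0 :=
      Path.loop_proj (by simp [mem_ignoring, insT]) (by simp +contextual [mem_ignoring])
    obtain rfl | ⟨w₁, w₂, c, hc, h, rfl, rfl⟩ := h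
    · exact mem_rel (q := 0) (q' := 0) rfl (by simp [insT, ignoring]) (head w)
    · refine mem_rel (q := 0) (q' := 1) rfl (by simp [insT, ignoring]) ?_
      rw [proj_append, proj_cons_of_mem (hE hc)]
      refine (head w₁).append (.cons (x := []) (y := [c]) (q' := 1)
        (by simp [mem_ignoring, insT, hc]) (Path.loop_proj ?_ (by simp +contextual [mem_ignoring])))
      intro a ha haS
      simp [mem_ignoring, insT, haS, proj_eq_nil_iff.1 h a ha]

theorem rel_insT (E : Set A) : (P.insT Set.univ E).rel = P.insObs E := by
  simpa [ignoring_empty, projObs_univ] using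
    P.rel_insT_ignoring (Set.subset_univ _) (Set.subset_univ E)

theorem rel_insT_ignoring_N {E : Set A} (hE : E ⊆ P.C) :
    ((P.insT P.Nᶜ E).ignoring P.N).rel = (P.insObs E).comp (projObs P.Nᶜ) := by
  simpa using P.rel_insT_ignoring (S := P.Nᶜ) (E := E) (fun _ => P.notMem_N_of_mem_C)
    fun _ h => P.notMem_N_of_mem_C (hE h)

/-- Deletion of the last confidential event, which is guessed in state `0`; a word without
confidential events is read in state `1`. -/
theorem isRational_delLast : IsRational {p : List A × List A | p.2 = delLast P.C p.1} := by
  let T : Transducer A A (Fin 2) :=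
    { init := {0, 1}
      trans := copy 0 0 Set.univ ∪ erase 0 1 P.C ∪ copy 1 1 P.Cᶜ
      finite_trans := Set.toFinite _
      final := {1} }
  refine ⟨Fin 2, inferInstance, T, Set.Subset.antisymm ?_ ?_⟩
  · refine rel_subset
      ![fun u v => ∃ w₁ w₂, ∃ c ∈ P.C, proj P.C w₂ = [] ∧ u = w₁ ++ c :: w₂ ∧ v = w₁ ++ w₂,
        fun u v => proj P.C u = [] ∧ v = u] ?_ ?_ ?_
    · simp [T]
    · intro q x y q' u v h hR
      simp only [T, Set.mem_union, mem_copy, mem_erase] at h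
      obtain (⟨rfl, rfl, a, ha, rfl, rfl⟩ | ⟨rfl, rfl, a, ha, rfl, rfl⟩) |
        ⟨rfl, rfl, a, ha, rfl, rfl⟩ := h
      · obtain ⟨w₁, w₂, c, hc, h, rfl, rfl⟩ := hR
        exact ⟨a :: w₁, w₂, c, hc, h, rfl, rfl⟩
      · obtain ⟨h, rfl⟩ := hR
        exact ⟨[], v, a, ha, h, rfl, rfl⟩
      · obtain ⟨h, rfl⟩ := hR
        exact ⟨(proj_cons_of_notMem ha).trans h, rfl⟩
    · rintro _ (rfl | rfl) u v h
      · obtain ⟨w₁, w₂, c, hc, h, rfl, rfl⟩ := h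
        exact (delLast_append_cons hc h).symm
      · obtain ⟨h, rfl⟩ := h
        exact (delLast_of_proj_eq_nil h).symm
  · rintro ⟨u, v⟩ (rfl : v = delLast P.C u)
    have tail {w : List A} (h : proj P.C w = []) : T.Path 1 w w 1 :=
      Path.loop_copy fun a ha => by simpa [T] using proj_eq_nil_iff.1 h a ha
    obtain h | ⟨w₁, w₂, c, hc, h, rfl⟩ := proj_eq_nil_or_exists_last P.C u
    · rw [delLast_of_proj_eq_nil h]
      exact mem_rel (q := 1) (q' := 1) (by simp [T]) rfl (tail h)
    · rw [delLast_append_cons hc h]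
      exact mem_rel (q := 0) (q' := 1) (by simp [T]) rfl
        ((Path.loop_copy (by simp [T])).append
          (.cons (x := [c]) (y := []) (q' := 1) (by simp [T, hc]) (tail h)))

/-- By `mem_delObs_iff` it suffices to guess the leftmost deleted letter: from then on, in state
`1`, every confidential letter is erased and all others are copied. -/
theorem rel_delT : P.delT.rel = P.delObs := by
  apply Set.Subset.antisymm
  · refine rel_subset ![fun u v => (u, v) ∈ P.delObs, fun u v => v = proj P.Cᶜ u] ?_ ?_
      (by simp [delT])
    · simp [delT, mem_delObs_iff]
    · simp only [mem_delObs_iff]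
      intro q x y q' u v h hR
      simp only [delT, Set.mem_union, mem_copy, mem_erase, P.mem_V_or_mem_N_iff] at h
      obtain ((⟨rfl, rfl, a, ha, rfl, rfl⟩ | ⟨rfl, rfl, a, ha, rfl, rfl⟩) |
        ⟨rfl, rfl, a, ha, rfl, rfl⟩) | ⟨rfl, rfl, a, ha, rfl, rfl⟩ := h
      · obtain rfl | ⟨w₁, w₂, c, hc, rfl, rfl⟩ := hR
        · exact .inl rfl
        · exact .inr ⟨a :: w₁, w₂, c, hc, rfl, rfl⟩
      · obtain rfl := hR
        exact .inr ⟨[], u, a, ha, rfl, rfl⟩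
      · obtain rfl := hR
        exact (proj_cons_of_mem ha).symm
      · obtain rfl := hR
        exact (proj_cons_of_notMem (by simpa using ha)).symm
  · rintro ⟨u, v⟩ h
    obtain rfl | ⟨w₁, w₂, c, hc, rfl, rfl⟩ := P.mem_delObs_iff.1 h
    · exact mem_rel (q := 0) (q' := 0) rfl (by simp [delT]) (Path.loop_copy (by simp [delT]))
    · exact mem_rel (q := 0) (q' := 1) rfl (by simp [delT])
        ((Path.loop_copy (by simp [delT])).append (.cons (x := [c]) (y := []) (q' := 1)
          (by simp [delT, hc])
          (Path.loop_proj (by simp [delT, P.mem_V_or_mem_N_iff]) (by simp [delT]))))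

theorem rel_bsdT₁ : P.bsdT₁.rel = P.bsdObs₁ := by
  apply Set.Subset.antisymm
  · refine rel_subset ![fun u z => (u, z) ∈ P.bsdObs₁,
      fun u z => proj P.C u = [] ∧ z = (proj P.V u).map some] ?_ ?_ (by simp [bsdT₁])
    · simp [bsdT₁, bsdObs₁]
    · intro q x y q' u z h hR
      simp only [bsdT₁, Set.mem_union, mem_copyM, mem_erase, mem_arcs] at h
      obtain ((⟨rfl, rfl, a, ha, rfl, rfl⟩ | ⟨rfl, rfl, a, ha, rfl, rfl⟩) |
        ⟨rfl, rfl, a, ha, rfl, rfl⟩) | ⟨rfl, rfl, a, ha, rfl, rfl⟩ := h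
      · obtain rfl | ⟨w₁, w₂, c, hc, h, rfl, rfl⟩ := hR
        · exact .inl rfl
        · exact .inr ⟨a :: w₁, w₂, c, hc, h, rfl, rfl⟩
      · obtain ⟨h, rfl⟩ := hR
        exact .inr ⟨[], u, a, ha, h, rfl, rfl⟩
      · obtain ⟨h, rfl⟩ := hR
        exact ⟨(P.proj_C_cons_of_mem_V ha).trans h, by simp [proj_cons_of_mem ha]⟩
      · obtain ⟨h, rfl⟩ := hR
        exact ⟨(P.proj_C_cons_of_mem_N ha).trans h, by simp [P.proj_V_cons_of_mem_N ha]⟩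
  · rintro ⟨u, z⟩ (rfl | ⟨w₁, w₂, c, hc, h, rfl, rfl⟩)
    · exact mem_rel (q := 0) (q' := 0) rfl (by simp [bsdT₁]) (Path.loop_map (by simp [bsdT₁]))
    · exact mem_rel (q := 0) (q' := 1) rfl (by simp [bsdT₁])
        ((Path.loop_map (by simp [bsdT₁])).append (.cons (x := [c]) (y := [none]) (q' := 1)
          (by simp [bsdT₁, hc]) (P.path_tail_map (by simp [bsdT₁]) (by simp [bsdT₁]) h)))

theorem rel_bsdT₂ : P.bsdT₂.rel = P.bsdObs₂ := by
  apply Set.Subset.antisymm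
  · refine rel_subset ![fun u z => (u, z) ∈ P.bsdObs₂,
      fun u z => proj P.C u = [] ∧ z = (proj P.V u).map some] ?_ ?_ (by simp [bsdT₂])
    · simp [bsdT₂, bsdObs₂]
    · intro q x y q' u z h hR
      simp only [bsdT₂, Set.mem_union, mem_copyM, mem_erase, Set.mem_singleton_iff,
        Prod.mk.injEq] at h
      obtain ((⟨rfl, rfl, a, ha, rfl, rfl⟩ | ⟨rfl, ⟨rfl, rfl⟩, rfl⟩) |
        ⟨rfl, rfl, a, ha, rfl, rfl⟩) | ⟨rfl, rfl, a, ha, rfl, rfl⟩ := h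
      · obtain rfl | ⟨w₁, w₂, h, rfl, rfl⟩ := hR
        · exact .inl rfl
        · exact .inr ⟨a :: w₁, w₂, h, rfl, rfl⟩
      · obtain ⟨h, rfl⟩ := hR
        exact .inr ⟨[], u, h, rfl, rfl⟩
      · obtain ⟨h, rfl⟩ := hR
        exact ⟨(P.proj_C_cons_of_mem_V ha).trans h, by simp [proj_cons_of_mem ha]⟩
      · obtain ⟨h, rfl⟩ := hR
        exact ⟨(P.proj_C_cons_of_mem_N ha).trans h, by simp [P.proj_V_cons_of_mem_N ha]⟩
  · rintro ⟨u, z⟩ (rfl | ⟨w₁, w₂, h, rfl, rfl⟩)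
    · exact mem_rel (q := 0) (q' := 0) rfl (by simp [bsdT₂]) (Path.loop_map (by simp [bsdT₂]))
    · exact mem_rel (q := 0) (q' := 1) rfl (by simp [bsdT₂])
        ((Path.loop_map (by simp [bsdT₂])).append (.cons (x := []) (y := [none]) (q' := 1)
          (by simp [bsdT₂]) (P.path_tail_map (by simp [bsdT₂]) (by simp [bsdT₂]) h)))

theorem rel_fcdT₁ {V' : Set A} (hV : V' ⊆ P.V) (C' : Set A) :
    (P.fcdT₁ V' C').rel = P.fcdObs₁ V' C' := by
  apply Set.Subset.antisymm
  · refine rel_subset ![fun u z => (u, z) ∈ P.fcdObs₁ V' C',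
      -- State `1` has written `#` and still has to read the letter of `V'`, which is why it is not
      -- final.
      fun u z => ∃ v ∈ V', ∃ w, proj P.C w = [] ∧ u = v :: w ∧ z = (proj P.V u).map some,
      fun u z => proj P.C u = [] ∧ z = (proj P.V u).map some] ?_ ?_ (by simp [fcdT₁])
    · simp [fcdT₁, fcdObs₁]
    · intro q x y q' u z h hR
      simp only [fcdT₁, Set.mem_union, mem_copyM, mem_erase, mem_arcs] at h
      obtain (((⟨rfl, rfl, a, ha, rfl, rfl⟩ | ⟨rfl, rfl, a, ha, rfl, rfl⟩) |
        ⟨rfl, rfl, a, ha, rfl, rfl⟩) | ⟨rfl, rfl, a, ha, rfl, rfl⟩) |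
        ⟨rfl, rfl, a, ha, rfl, rfl⟩ := h
      · obtain rfl | ⟨w₁, w₂, c, hc, v, hv, h, rfl, rfl⟩ := hR
        · exact .inl rfl
        · exact .inr ⟨a :: w₁, w₂, c, hc, v, hv, h, rfl, rfl⟩
      · obtain ⟨v, hv, w, h, rfl, rfl⟩ := hR
        exact .inr ⟨[], w, a, ha, v, hv, h, rfl, rfl⟩
      · obtain ⟨h, rfl⟩ := hR
        exact ⟨a, ha, u, h, rfl, by simp [proj_cons_of_mem (hV ha)]⟩
      · obtain ⟨h, rfl⟩ := hR
        exact ⟨(P.proj_C_cons_of_mem_V ha).trans h, by simp [proj_cons_of_mem ha]⟩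
      · obtain ⟨h, rfl⟩ := hR
        exact ⟨(P.proj_C_cons_of_mem_N ha).trans h, by simp [P.proj_V_cons_of_mem_N ha]⟩
  · rintro ⟨u, z⟩ (rfl | ⟨w₁, w₂, c, hc, v, hv, h, rfl, rfl⟩)
    · exact mem_rel (q := 0) (q' := 0) rfl (by simp [fcdT₁]) (Path.loop_map (by simp [fcdT₁]))
    · rw [marked, proj_cons_of_mem (hV hv)]
      exact mem_rel (q := 0) (q' := 2) rfl (by simp [fcdT₁])
        ((Path.loop_map (by simp [fcdT₁])).append (.cons (x := [c]) (y := [none]) (q' := 1)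
          (by simp [fcdT₁, hc]) (.cons (x := [v]) (y := [some v]) (q' := 2) (by simp [fcdT₁, hv])
          (P.path_tail_map (by simp [fcdT₁]) (by simp [fcdT₁]) h))))

theorem rel_fcdT₂ {V' : Set A} (hV : V' ⊆ P.V) (N' : Set A) :
    (P.fcdT₂ V' N').rel = P.fcdObs₂ V' N' := by
  apply Set.Subset.antisymm
  · refine rel_subset ![fun u z => (u, z) ∈ P.fcdObs₂ V' N',
      -- State `1` skips the part of `δ` that is still unread; only a letter of `V'` leads on to the
      -- final state `2`.
      fun u z => ∃ δ, ∃ v ∈ V', ∃ w, (∀ n ∈ δ, n ∈ N') ∧ proj P.C w = [] ∧ u = δ ++ v :: w ∧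
        z = (proj P.V (v :: w)).map some,
      fun u z => proj P.C u = [] ∧ z = (proj P.V u).map some] ?_ ?_ (by simp [fcdT₂])
    · simp [fcdT₂, fcdObs₂]
    · intro q x y q' u z h hR
      simp only [fcdT₂, Set.mem_union, mem_copyM, mem_erase, Set.mem_singleton_iff,
        Prod.mk.injEq] at h
      obtain ((((⟨rfl, rfl, a, ha, rfl, rfl⟩ | ⟨rfl, ⟨rfl, rfl⟩, rfl⟩) |
        ⟨rfl, rfl, a, ha, rfl, rfl⟩) | ⟨rfl, rfl, a, ha, rfl, rfl⟩) |
        ⟨rfl, rfl, a, ha, rfl, rfl⟩) | ⟨rfl, rfl, a, ha, rfl, rfl⟩ := h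
      · obtain rfl | ⟨w₁, δ, w₂, v, hv, hδ, h, rfl, rfl⟩ := hR
        · exact .inl rfl
        · exact .inr ⟨a :: w₁, δ, w₂, v, hv, hδ, h, rfl, rfl⟩
      · obtain ⟨δ, v, hv, w, hδ, h, rfl, rfl⟩ := hR
        exact .inr ⟨[], δ, w, v, hv, hδ, h, rfl, rfl⟩
      · obtain ⟨δ, v, hv, w, hδ, h, rfl, rfl⟩ := hR
        exact ⟨a :: δ, v, hv, w, by simpa using ⟨ha, hδ⟩, h, rfl, rfl⟩
      · obtain ⟨h, rfl⟩ := hR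
        exact ⟨[], a, ha, u, by simp, h, rfl, by simp [proj_cons_of_mem (hV ha)]⟩
      · obtain ⟨h, rfl⟩ := hR
        exact ⟨(P.proj_C_cons_of_mem_V ha).trans h, by simp [proj_cons_of_mem ha]⟩
      · obtain ⟨h, rfl⟩ := hR
        exact ⟨(P.proj_C_cons_of_mem_N ha).trans h, by simp [P.proj_V_cons_of_mem_N ha]⟩
  · rintro ⟨u, z⟩ (rfl | ⟨w₁, δ, w₂, v, hv, hδ, h, rfl, rfl⟩)
    · exact mem_rel (q := 0) (q' := 0) rfl (by simp [fcdT₂]) (Path.loop_map (by simp [fcdT₂]))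
    · rw [marked, proj_cons_of_mem (hV hv), List.append_assoc]
      exact mem_rel (q := 0) (q' := 2) rfl (by simp [fcdT₂])
        ((Path.loop_map (by simp [fcdT₂])).append (.cons (x := []) (y := [none]) (q' := 1)
          (by simp [fcdT₂]) ((Path.loop_erase (q := 1) (by simpa [fcdT₂] using hδ)).append
          (.cons (x := [v]) (y := [some v]) (q' := 2) (by simp [fcdT₂, hv])
          (P.path_tail_map (by simp [fcdT₂]) (by simp [fcdT₂]) h)))))

theorem rel_bsiT₁ (E : Set A) : (P.bsiT₁ E).rel = P.bsiObs₁ E := by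
  apply Set.Subset.antisymm
  · refine rel_subset ![fun u z => (u, z) ∈ P.bsiObs₁ E,
      fun u z => proj P.C u = [] ∧ z = proj P.V u] ?_ ?_ (by simp [bsiT₁])
    · simp [bsiT₁, bsiObs₁]
    · intro q x y q' u z h hR
      simp only [bsiT₁, Set.mem_union, mem_copy, mem_erase, mem_emit] at h
      obtain ((⟨rfl, rfl, a, ha, rfl, rfl⟩ | ⟨rfl, rfl, a, ha, rfl, rfl⟩) |
        ⟨rfl, rfl, a, ha, rfl, rfl⟩) | ⟨rfl, rfl, a, ha, rfl, rfl⟩ := h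
      · obtain rfl | ⟨w₁, w₂, c, hc, h, rfl, rfl⟩ := hR
        · exact .inl rfl
        · exact .inr ⟨a :: w₁, w₂, c, hc, h, rfl, rfl⟩
      · obtain ⟨h, rfl⟩ := hR
        exact .inr ⟨[], u, a, ha, h, rfl, rfl⟩
      · obtain ⟨h, rfl⟩ := hR
        exact ⟨(P.proj_C_cons_of_mem_V ha).trans h, (proj_cons_of_mem ha).symm⟩
      · obtain ⟨h, rfl⟩ := hR
        exact ⟨(P.proj_C_cons_of_mem_N ha).trans h, (P.proj_V_cons_of_mem_N ha).symm⟩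
  · rintro ⟨u, z⟩ (rfl | ⟨w₁, w₂, c, hc, h, rfl, rfl⟩)
    · exact mem_rel (q := 0) (q' := 0) rfl (by simp [bsiT₁]) (Path.loop_copy (by simp [bsiT₁]))
    · exact mem_rel (q := 0) (q' := 1) rfl (by simp [bsiT₁])
        ((Path.loop_copy (by simp [bsiT₁])).append (.cons (x := []) (y := [c]) (q' := 1)
          (by simp [bsiT₁, hc]) (P.path_tail (by simp [bsiT₁]) (by simp [bsiT₁]) h)))

theorem rel_bsiT₂ : P.bsiT₂.rel = P.bsiObs₂ := by
  apply Set.Subset.antisymm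
  · refine rel_subset ![fun u z => (u, z) ∈ P.bsiObs₂,
      fun u z => proj P.C u = [] ∧ z = proj P.V u] ?_ ?_ (by simp [bsiT₂])
    · simp [bsiT₂, bsiObs₂]
    · intro q x y q' u z h hR
      simp only [bsiT₂, Set.mem_union, mem_copy, mem_erase] at h
      obtain ((⟨rfl, rfl, a, ha, rfl, rfl⟩ | ⟨rfl, rfl, a, ha, rfl, rfl⟩) |
        ⟨rfl, rfl, a, ha, rfl, rfl⟩) | ⟨rfl, rfl, a, ha, rfl, rfl⟩ := h
      · obtain rfl | ⟨w₁, w₂, c, hc, h, rfl, rfl⟩ := hR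
        · exact .inl rfl
        · exact .inr ⟨a :: w₁, w₂, c, hc, h, rfl, rfl⟩
      · obtain ⟨h, rfl⟩ := hR
        exact .inr ⟨[], u, a, ha, h, rfl, rfl⟩
      · obtain ⟨h, rfl⟩ := hR
        exact ⟨(P.proj_C_cons_of_mem_V ha).trans h, (proj_cons_of_mem ha).symm⟩
      · obtain ⟨h, rfl⟩ := hR
        exact ⟨(P.proj_C_cons_of_mem_N ha).trans h, (P.proj_V_cons_of_mem_N ha).symm⟩
  · rintro ⟨u, z⟩ (rfl | ⟨w₁, w₂, c, hc, h, rfl, rfl⟩)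
    · exact mem_rel (q := 0) (q' := 0) rfl (by simp [bsiT₂]) (Path.loop_copy (by simp [bsiT₂]))
    · exact mem_rel (q := 0) (q' := 1) rfl (by simp [bsiT₂])
        ((Path.loop_copy (by simp [bsiT₂])).append (.cons (x := [c]) (y := [c]) (q' := 1)
          (by simp [bsiT₂, hc]) (P.path_tail (by simp [bsiT₂]) (by simp [bsiT₂]) h)))

theorem rel_fciT₁ (V' E : Set A) : (P.fciT₁ V' E).rel = P.fciObs₁ V' E := by
  apply Set.Subset.antisymm
  · refine rel_subset ![fun u z => (u, z) ∈ P.fciObs₁ V' E,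
      fun u z => ∃ v ∈ V', ∃ w, proj P.C w = [] ∧ u = v :: w ∧ z = v :: proj P.V w,
      fun u z => proj P.C u = [] ∧ z = proj P.V u] ?_ ?_ (by simp [fciT₁])
    · simp [fciT₁, fciObs₁]
    · intro q x y q' u z h hR
      simp only [fciT₁, Set.mem_union, mem_copy, mem_erase, mem_emit] at h
      obtain (((⟨rfl, rfl, a, ha, rfl, rfl⟩ | ⟨rfl, rfl, a, ha, rfl, rfl⟩) |
        ⟨rfl, rfl, a, ha, rfl, rfl⟩) | ⟨rfl, rfl, a, ha, rfl, rfl⟩) |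
        ⟨rfl, rfl, a, ha, rfl, rfl⟩ := h
      · obtain rfl | ⟨w₁, w₂, c, hc, v, hv, h, rfl, rfl⟩ := hR
        · exact .inl rfl
        · exact .inr ⟨a :: w₁, w₂, c, hc, v, hv, h, rfl, rfl⟩
      · obtain ⟨v, hv, w, h, rfl, rfl⟩ := hR
        exact .inr ⟨[], w, a, ha, v, hv, h, rfl, rfl⟩
      · obtain ⟨h, rfl⟩ := hR
        exact ⟨a, ha, u, h, rfl, rfl⟩
      · obtain ⟨h, rfl⟩ := hR
        exact ⟨(P.proj_C_cons_of_mem_V ha).trans h, (proj_cons_of_mem ha).symm⟩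
      · obtain ⟨h, rfl⟩ := hR
        exact ⟨(P.proj_C_cons_of_mem_N ha).trans h, (P.proj_V_cons_of_mem_N ha).symm⟩
  · rintro ⟨u, z⟩ (rfl | ⟨w₁, w₂, c, hc, v, hv, h, rfl, rfl⟩)
    · exact mem_rel (q := 0) (q' := 0) rfl (by simp [fciT₁]) (Path.loop_copy (by simp [fciT₁]))
    · exact mem_rel (q := 0) (q' := 2) rfl (by simp [fciT₁])
        ((Path.loop_copy (by simp [fciT₁])).append (.cons (x := []) (y := [c]) (q' := 1)
          (by simp [fciT₁, hc]) (.cons (x := [v]) (y := [v]) (q' := 2) (by simp [fciT₁, hv])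
          (P.path_tail (by simp [fciT₁]) (by simp [fciT₁]) h))))

theorem rel_fciT₂ (V' C' N' : Set A) : (P.fciT₂ V' C' N').rel = P.fciObs₂ V' C' N' := by
  apply Set.Subset.antisymm
  · refine rel_subset ![fun u z => (u, z) ∈ P.fciObs₂ V' C' N',
      fun u z => ∃ δ, ∃ v ∈ V', ∃ w, (∀ n ∈ δ, n ∈ N') ∧ proj P.C w = [] ∧ u = δ ++ v :: w ∧
        z = v :: proj P.V w,
      fun u z => proj P.C u = [] ∧ z = proj P.V u] ?_ ?_ (by simp [fciT₂])
    · simp [fciT₂, fciObs₂]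
    · intro q x y q' u z h hR
      simp only [fciT₂, Set.mem_union, mem_copy, mem_erase] at h
      obtain ((((⟨rfl, rfl, a, ha, rfl, rfl⟩ | ⟨rfl, rfl, a, ha, rfl, rfl⟩) |
        ⟨rfl, rfl, a, ha, rfl, rfl⟩) | ⟨rfl, rfl, a, ha, rfl, rfl⟩) |
        ⟨rfl, rfl, a, ha, rfl, rfl⟩) | ⟨rfl, rfl, a, ha, rfl, rfl⟩ := h
      · obtain rfl | ⟨w₁, δ, w₂, c, hc, v, hv, hδ, h, rfl, rfl⟩ := hR
        · exact .inl rfl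
        · exact .inr ⟨a :: w₁, δ, w₂, c, hc, v, hv, hδ, h, rfl, rfl⟩
      · obtain ⟨δ, v, hv, w, hδ, h, rfl, rfl⟩ := hR
        exact .inr ⟨[], δ, w, a, ha, v, hv, hδ, h, rfl, rfl⟩
      · obtain ⟨δ, v, hv, w, hδ, h, rfl, rfl⟩ := hR
        exact ⟨a :: δ, v, hv, w, by simpa using ⟨ha, hδ⟩, h, rfl, rfl⟩
      · obtain ⟨h, rfl⟩ := hR
        exact ⟨[], a, ha, u, by simp, h, rfl, rfl⟩
      · obtain ⟨h, rfl⟩ := hR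
        exact ⟨(P.proj_C_cons_of_mem_V ha).trans h, (proj_cons_of_mem ha).symm⟩
      · obtain ⟨h, rfl⟩ := hR
        exact ⟨(P.proj_C_cons_of_mem_N ha).trans h, (P.proj_V_cons_of_mem_N ha).symm⟩
  · rintro ⟨u, z⟩ (rfl | ⟨w₁, δ, w₂, c, hc, v, hv, hδ, h, rfl, rfl⟩)
    · exact mem_rel (q := 0) (q' := 0) rfl (by simp [fciT₂]) (Path.loop_copy (by simp [fciT₂]))
    · rw [List.append_assoc]
      exact mem_rel (q := 0) (q' := 2) rfl (by simp [fciT₂])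
        ((Path.loop_copy (by simp [fciT₂])).append (.cons (x := [c]) (y := [c]) (q' := 1)
          (by simp [fciT₂, hc]) ((Path.loop_erase (by simpa [fciT₂] using hδ)).append
          (.cons (x := [v]) (y := [v]) (q' := 2) (by simp [fciT₂, hv])
          (P.path_tail (by simp [fciT₂]) (by simp [fciT₂]) h)))))

/-- The loops at state `0` realize equality of `X`-projections: letters of `X` are copied, the
others are erased from the input or added to the output independently. The only way out is `c|c`,
after which nothing is read, so the input must end with `c`. -/
theorem rel_admT (X : Set A) (c : A) : (P.admT X c).rel = P.admObs X c := by
  apply Set.Subset.antisymm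
  · refine rel_subset ![fun u z => (u, z) ∈ P.admObs X c,
      fun u z => u = [] ∧ ∀ a ∈ z, a ∈ P.V ∪ P.N] ?_ ?_ (by simp [admT])
    · simp [admT]
    · intro q x y q' u z h hR
      simp only [admT, Set.mem_union, mem_copy, mem_erase, mem_emit] at h
      obtain (((⟨rfl, rfl, a, ha, rfl, rfl⟩ | ⟨rfl, rfl, a, ha, rfl, rfl⟩) |
        ⟨rfl, rfl, a, ha, rfl, rfl⟩) | ⟨rfl, rfl, a, ha, rfl, rfl⟩) |
        ⟨rfl, rfl, a, ha, rfl, rfl⟩ := h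
      · obtain ⟨u₁, v₁, v₂, rfl, h, h₂, rfl⟩ := hR
        exact ⟨a :: u₁, a :: v₁, v₂, rfl, by rw [proj_cons_of_mem ha, proj_cons_of_mem ha, h],
          h₂, rfl⟩
      · obtain ⟨u₁, v₁, v₂, rfl, h, h₂, rfl⟩ := hR
        exact ⟨a :: u₁, v₁, v₂, rfl, by rw [proj_cons_of_notMem ha, h], h₂, rfl⟩
      · obtain ⟨u₁, v₁, v₂, rfl, h, h₂, rfl⟩ := hR
        exact ⟨u₁, a :: v₁, v₂, rfl, by rw [proj_cons_of_notMem ha, h], h₂, rfl⟩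
      · obtain ⟨rfl, h⟩ := hR
        obtain rfl := ha
        exact ⟨[], [], z, rfl, rfl, h, rfl⟩
      · obtain ⟨rfl, h⟩ := hR
        exact ⟨rfl, List.forall_mem_cons.2 ⟨ha, h⟩⟩
  · rintro ⟨u, z⟩ ⟨u₁, v₁, v₂, rfl, h, h₂, rfl⟩
    have head₁ (w) : (P.admT X c).Path 0 w (proj X w) 0 :=
      Path.loop_proj (by simp [admT]) (by simp +contextual [admT])
    -- Induction on the output. Before a letter of `X` is copied, the input letters preceding it,
    -- all outside `X`, are consumed; a letter outside `X` is simply emitted.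
    have head₂ (v : List A) : ∀ u, proj X v = proj X u → (P.admT X c).Path 0 u v 0 := by
      induction v with
      | nil =>
        intro u h
        rw [← proj_nil (B := X), h]
        exact head₁ u
      | cons a v ih =>
        intro u h
        by_cases ha : a ∈ X
        · rw [proj_cons_of_mem ha] at h
          obtain ⟨s, t, rfl, hs, ht⟩ := exists_of_proj_eq_cons h.symm
          have := head₁ s
          rw [hs] at this
          exact this.append (.cons (x := [a]) (y := [a]) (q' := 0) (by simp [admT, ha])
            (ih t ht.symm))
        · rw [proj_cons_of_notMem ha] at h
          exact .cons (x := []) (y := [a]) (q' := 0) (by simp [admT, ha]) (ih u h)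
    exact mem_rel (q := 0) (q' := 1) rfl rfl
      ((head₂ v₁ u₁ h).append (.cons (x := [c]) (y := [c]) (q' := 1) (by simp [admT])
        (Path.loop_emit (by simpa [admT] using h₂))))

end View

/-! ### The predicates as inclusions between observations -/

namespace View

variable {A : Type*} {P : View A} {L : Language A} {X V' C' N' : Set A}

/-- The letter `#` occurs exactly once, so it is the last letter of the code in `{#}` and fixes the
factorization. -/
theorem marked_inj {w₁ w₂ u₁ u₂ : List A} (h : P.marked w₁ w₂ = P.marked u₁ u₂) :
    w₁ = u₁ ∧ proj P.V w₂ = proj P.V u₂ := by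
  have hs (w : List A) : proj {none} (w.map some) = [] := by simp [proj_eq_nil_iff]
  obtain ⟨h₁, -, h₂⟩ :=
    eq_of_append_cons_eq (Set.mem_singleton none) (Set.mem_singleton none) (hs _) (hs _) h
  exact ⟨(Option.some_injective A).list_map h₁, (Option.some_injective A).list_map h₂⟩

theorem marked_ne_map {w₁ w₂ u : List A} : P.marked w₁ w₂ ≠ u.map some := by
  intro h
  have : none ∈ u.map some := h ▸ by simp [marked]
  simp at this

/-- A word that agrees with `w₁w₂` up to internal events factors accordingly. -/
theorem exists_simN_append {w₁ w₂ w : List A}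
    (h : proj P.Nᶜ w = proj P.Nᶜ (w₁ ++ w₂)) :
    ∃ w₁' w₂', P.SimN w₁ w₁' ∧ P.SimN w₂ w₂' ∧ w = w₁' ++ w₂' := by
  rw [proj_append] at h
  obtain ⟨u₁, u₂, rfl, h₁, h₂⟩ := proj_eq_append_iff.1 h
  exact ⟨u₁, u₂, h₁.symm, h₂.symm, rfl⟩

/-- The letter `c` is not internal, so it survives the projection and can be located in `w`.
Internal letters `s` just before it are moved to the left factor, where they do not affect `∼`. -/
theorem exists_simN_append_cons {w₁ w₂ w : List A} {c : A} (hc : c ∈ P.C)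
    (h : proj P.Nᶜ w = proj P.Nᶜ (w₁ ++ c :: w₂)) :
    ∃ w₁' w₂', P.SimN w₁ w₁' ∧ P.SimN w₂ w₂' ∧ w = w₁' ++ c :: w₂' := by
  obtain ⟨u₁, u₂, h₁, h₂, rfl⟩ := exists_simN_append h
  rw [SimN, proj_cons_of_mem (P.notMem_N_of_mem_C hc)] at h₂
  obtain ⟨s, t, rfl, hs, ht⟩ := exists_of_proj_eq_cons h₂.symm
  exact ⟨u₁ ++ s, t, by simpa [SimN, hs] using h₁, ht.symm, by simp⟩

theorem SimN.append {w₁ w₂ u₁ u₂ : List A} (h₁ : P.SimN w₁ u₁) (h₂ : P.SimN w₂ u₂) :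
    P.SimN (w₁ ++ w₂) (u₁ ++ u₂) := by
  rw [SimN, proj_append, proj_append, show proj _ w₁ = _ from h₁, show proj _ w₂ = _ from h₂]

theorem simN_append_cons {w₁ w₂ u₁ u₂ : List A} (c : A) (h₁ : P.SimN w₁ u₁) (h₂ : P.SimN w₂ u₂) :
    P.SimN (w₁ ++ c :: w₂) (u₁ ++ c :: u₂) :=
  h₁.append (SimN.append (w₁ := [c]) (u₁ := [c]) rfl h₂)

/-- Both the given word and the observer's output have `c` as their last confidential letter, so the
two factorizations agree. The tail carries no information, hence the observer tests admissibility
after `w₁` alone. -/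
theorem append_cons_mem_observe_admObs {w₁ w₂ : List A} {c : A} (hc : c ∈ P.C)
    (h : proj P.C w₂ = []) :
    w₁ ++ c :: w₂ ∈ observe (P.admObs X c) L ↔ Adm X c w₁ L := by
  constructor
  · rintro ⟨_, hu, u₁, v₁, v₂, rfl, hX, hv, heq⟩
    have hv : proj P.C v₂ = [] :=
      proj_eq_nil_iff.2 fun a ha => P.mem_V_or_mem_N_iff.1 (hv a ha)
    obtain ⟨rfl, -, -⟩ := eq_of_append_cons_eq hc hc h hv heq
    exact ⟨u₁, hu, hX⟩
  · rintro ⟨w₃, hw, hX⟩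
    exact ⟨_, hw, w₃, w₁, w₂, rfl, hX,
      fun a ha => P.mem_V_or_mem_N_iff.2 (proj_eq_nil_iff.1 h a ha), rfl⟩

theorem SR_iff : P.SR L ↔ observe (projObs P.Cᶜ) L ≤ L := by
  constructor
  · rintro h _ ⟨u, hu, rfl⟩
    exact h u hu
  · exact fun h w hw => h ⟨w, hw, rfl⟩

theorem R_iff : P.R L ↔ observe (projObs P.V) L ≤ observe (projObs P.Nᶜ) L := by
  constructor
  · rintro h _ ⟨u, hu, rfl⟩
    obtain ⟨w, hw, hC, hV⟩ := h u hu
    exact ⟨w, hw, (P.proj_compl_N_of_proj_C hC).trans hV |>.symm⟩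
  · intro h w hw
    -- The projection of `u` to `V ∪ C` is a visible word: its confidential part gives `π_C(u) = ε`,
    -- and its visible part gives `π_V(u) = π_V(w)`.
    obtain ⟨u, hu, he : proj _ w = _⟩ := h ⟨w, hw, rfl⟩
    refine ⟨u, hu, ?_, ?_⟩
    · rw [← P.proj_C_proj_compl_N, ← he, proj_C_proj_V]
    · rw [← P.proj_V_proj_compl_N, ← he, proj_proj, Set.inter_self]

theorem SD.delLast_mem (h : P.SD L) {u : List A} (hu : u ∈ L) : delLast P.C u ∈ L := by
  obtain hC | ⟨w₁, w₂, c, hc, hC, rfl⟩ := proj_eq_nil_or_exists_last P.C u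
  · rwa [delLast_of_proj_eq_nil hC]
  · rw [delLast_append_cons hc hC]
    exact h _ _ c hc hu hC

theorem SD_iff_delLast : P.SD L ↔ observe {p | p.2 = delLast P.C p.1} L ≤ L := by
  constructor
  · rintro h v ⟨u, hu, hv : v = delLast P.C u⟩
    exact hv ▸ h.delLast_mem hu
  · exact fun h w₁ w₂ c hc hw hC => h ⟨_, hw, (delLast_append_cons hc hC).symm⟩

theorem SD_iff_lDelObs : P.SD L ↔ observe P.lDelObs L ≤ L := by
  constructor
  · rintro h _ ⟨u, hu, rfl | rfl⟩
    · exact hu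
    · exact h.delLast_mem hu
  · exact fun h w₁ w₂ c hc hw hC => h ⟨_, hw, .inr (delLast_append_cons hc hC).symm⟩

theorem SD_iff_delObs : P.SD L ↔ observe P.delObs L ≤ L := by
  constructor
  · rintro h _ ⟨u, hu, k, rfl⟩
    induction k with
    | zero => exact hu
    | succ k ih =>
      rw [Function.iterate_succ_apply']
      exact h.delLast_mem ih
  · exact fun h w₁ w₂ c hc hw hC => h ⟨_, hw, 1, (delLast_append_cons hc hC).symm⟩

theorem D_iff : P.D L ↔
    observe (P.lDelObs.comp (projObs P.Nᶜ)) L ≤ observe (projObs P.Nᶜ) L := by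
  constructor
  · rintro h _ ⟨u, hu, w, hw, rfl⟩
    obtain rfl | ⟨w₁, w₂, c, hc, hC, rfl, rfl⟩ := P.mem_lDelObs_iff.1 hw
    · exact ⟨w, hu, rfl⟩
    · obtain ⟨w₁', w₂', h₁, h₂, h⟩ := h w₁ w₂ c hc hu hC
      exact ⟨_, h, h₁.append h₂⟩
  · intro h w₁ w₂ c hc hw hC
    obtain ⟨w, hw, he⟩ :=
      h ⟨_, hw, w₁ ++ w₂, P.mem_lDelObs_iff.2 (.inr ⟨w₁, w₂, c, hc, hC, rfl, rfl⟩), rfl⟩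
    obtain ⟨w₁', w₂', h₁, h₂, rfl⟩ := exists_simN_append he.symm
    exact ⟨w₁', w₂', h₁, h₂, hw⟩

theorem BSD_iff : P.BSD L ↔ observe P.bsdObs₁ L ≤ observe P.bsdObs₂ L := by
  constructor
  · rintro h _ ⟨u, hu, rfl | ⟨w₁, w₂, c, hc, hC, rfl, rfl⟩⟩
    · exact ⟨u, hu, .inl rfl⟩
    · obtain ⟨w₂', hw, h⟩ := h w₁ w₂ c hc hu hC
      exact ⟨_, h, .inr ⟨w₁, w₂', hw.proj_C ▸ hC, rfl, by rw [marked, marked, hw.proj_V]⟩⟩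
  · intro h w₁ w₂ c hc hw hC
    obtain ⟨u, hu, he | ⟨u₁, u₂, hC', rfl, he⟩⟩ := h ⟨_, hw, .inr ⟨w₁, w₂, c, hc, hC, rfl, rfl⟩⟩
    -- The identity branch cannot account for a word that contains `#`.
    · exact absurd he marked_ne_map
    · obtain ⟨rfl, hm⟩ := marked_inj he
      exact ⟨u₂, simN_of_proj_V hC hC' hm, hu⟩

theorem FCD_iff (hV : V' ⊆ P.V) :
    P.FCD V' C' N' L ↔ observe (P.fcdObs₁ V' C') L ≤ observe (P.fcdObs₂ V' N') L := by
  constructor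
  · rintro h _ ⟨u, hu, rfl | ⟨w₁, w₂, c, hc, v, hv, hC, rfl, rfl⟩⟩
    · exact ⟨u, hu, .inl rfl⟩
    · obtain ⟨δ, w₂', hδ, hw, h⟩ := h w₁ w₂ c hc v hv hu hC
      exact ⟨_, h, .inr ⟨w₁, δ, w₂', v, hv, hδ, hw.proj_C ▸ hC, rfl,
        by simp only [marked, proj_cons_of_mem (hV hv), hw.proj_V]⟩⟩
  · intro h w₁ w₂ c hc v hv hw hC
    obtain ⟨u, hu, he | ⟨u₁, δ, u₂, v', hv', hδ, hC', rfl, he⟩⟩ :=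
      h ⟨_, hw, .inr ⟨w₁, w₂, c, hc, v, hv, hC, rfl, rfl⟩⟩
    · exact absurd he marked_ne_map
    · obtain ⟨rfl, hm⟩ := marked_inj he
      rw [proj_cons_of_mem (hV hv), proj_cons_of_mem (hV hv'), List.cons.injEq] at hm
      obtain ⟨rfl, hm⟩ := hm
      exact ⟨δ, u₂, hδ, simN_of_proj_V hC hC' hm, hu⟩

theorem SI_iff : P.SI L ↔ observe (P.insObs P.C) L ≤ L := by
  constructor
  · rintro h _ ⟨u, hu, rfl | ⟨w₁, w₂, c, hc, hC, rfl, rfl⟩⟩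
    · exact hu
    · exact h w₁ w₂ hu hC c hc
  · exact fun h w₁ w₂ hw hC c hc => h ⟨_, hw, .inr ⟨w₁, w₂, c, hc, hC, rfl, rfl⟩⟩

theorem I_iff : P.I L ↔
    observe ((P.insObs P.C).comp (projObs P.Nᶜ)) L ≤ observe (projObs P.Nᶜ) L := by
  constructor
  · rintro h _ ⟨u, hu, w, rfl | ⟨w₁, w₂, c, hc, hC, rfl, rfl⟩, rfl⟩
    · exact ⟨w, hu, rfl⟩
    · obtain ⟨w₁', w₂', h₁, h₂, h⟩ := h w₁ w₂ hu hC c hc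
      exact ⟨_, h, simN_append_cons c h₁ h₂⟩
  · intro h w₁ w₂ hw hC c hc
    obtain ⟨w, hw, he⟩ := h ⟨_, hw, w₁ ++ c :: w₂, .inr ⟨w₁, w₂, c, hc, hC, rfl, rfl⟩, rfl⟩
    obtain ⟨w₁', w₂', h₁, h₂, rfl⟩ := exists_simN_append_cons hc he.symm
    exact ⟨w₁', w₂', h₁, h₂, hw⟩

/-- Membership in `BSI₂(L)` is the conclusion of `BSI`. -/
theorem mem_observe_bsiObs₂_iff {w₁ w₂ : List A} {c : A} (hc : c ∈ P.C) (hC : proj P.C w₂ = []) :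
    w₁ ++ c :: proj P.V w₂ ∈ observe P.bsiObs₂ L ↔ ∃ w₂', P.SimN w₂ w₂' ∧ w₁ ++ c :: w₂' ∈ L := by
  constructor
  · rintro ⟨u, hu, rfl | ⟨u₁, u₂, c', hc', hC', rfl, he⟩⟩
    -- In the identity branch the code itself lies in `L`, and `π_V(w₂) ∼ w₂` makes it a valid
    -- witness. Hence no fresh letter is needed here.
    · exact ⟨_, simN_proj_V hC, hu⟩
    · obtain ⟨rfl, rfl, ht⟩ :=
        eq_of_append_cons_eq hc hc' P.proj_C_proj_V P.proj_C_proj_V he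
      exact ⟨u₂, simN_of_proj_V hC hC' ht, hu⟩
  · rintro ⟨w₂', hw, h⟩
    exact ⟨_, h, .inr ⟨w₁, w₂', c, hc, hw.proj_C ▸ hC, rfl, by rw [hw.proj_V]⟩⟩

/-- Membership in `FCI₂(L)` is the conclusion of `FCI`. -/
theorem mem_observe_fciObs₂_iff {w₁ w₂ : List A} {c v : A} (hV : V' ⊆ P.V) (hC' : C' ⊆ P.C)
    (hc : c ∈ C') (hv : v ∈ V') (hC : proj P.C w₂ = []) :
    w₁ ++ c :: v :: proj P.V w₂ ∈ observe (P.fciObs₂ V' C' N') L ↔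
      ∃ δ w₂', (∀ n ∈ δ, n ∈ N') ∧ P.SimN w₂ w₂' ∧ w₁ ++ c :: δ ++ v :: w₂' ∈ L := by
  have hCV {x : A} {w : List A} (hx : x ∈ V') : proj P.C (x :: proj P.V w) = [] :=
    (P.proj_C_cons_of_mem_V (hV hx)).trans P.proj_C_proj_V
  constructor
  · rintro ⟨u, hu, rfl | ⟨u₁, δ, u₂, c', hc', v', hv', hδ, hu₂, rfl, he⟩⟩
    -- Again the code is its own witness, with `δ` empty.
    · exact ⟨[], _, by simp, simN_proj_V hC, by simpa using hu⟩
    · obtain ⟨rfl, rfl, ht⟩ := eq_of_append_cons_eq (hC' hc) (hC' hc') (hCV hv) (hCV hv') he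
      obtain ⟨rfl, hV'⟩ := List.cons.inj ht
      exact ⟨δ, u₂, hδ, simN_of_proj_V hC hu₂ hV', hu⟩
  · rintro ⟨δ, w₂', hδ, hw, h⟩
    exact ⟨_, h, .inr ⟨w₁, δ, w₂', c, hc, v, hv, hδ, hw.proj_C ▸ hC, rfl, by rw [hw.proj_V]⟩⟩

theorem BSI_iff : P.BSI L ↔ observe (P.bsiObs₁ P.C) L ≤ observe P.bsiObs₂ L := by
  constructor
  · rintro h _ ⟨u, hu, rfl | ⟨w₁, w₂, c, hc, hC, rfl, rfl⟩⟩
    · exact ⟨_, hu, .inl rfl⟩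
    · exact (mem_observe_bsiObs₂_iff hc hC).2 (h w₁ w₂ hu hC c hc)
  · exact fun h w₁ w₂ hw hC c hc =>
      (mem_observe_bsiObs₂_iff hc hC).1 (h ⟨_, hw, .inr ⟨w₁, w₂, c, hc, hC, rfl, rfl⟩⟩)

theorem FCI_iff (hV : V' ⊆ P.V) (hC' : C' ⊆ P.C) :
    P.FCI V' C' N' L ↔ observe (P.fciObs₁ V' C') L ≤ observe (P.fciObs₂ V' C' N') L := by
  constructor
  · rintro h _ ⟨u, hu, rfl | ⟨w₁, w₂, c, hc, v, hv, hC, rfl, rfl⟩⟩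
    · exact ⟨_, hu, .inl rfl⟩
    · exact (mem_observe_fciObs₂_iff hV hC' hc hv hC).2 (h w₁ w₂ v hv hu hC c hc)
  · exact fun h w₁ w₂ v hv hw hC c hc =>
      (mem_observe_fciObs₂_iff hV hC' hc hv hC).1
        (h ⟨_, hw, .inr ⟨w₁, w₂, c, hc, v, hv, hC, rfl, rfl⟩⟩)

theorem SIA_iff : P.SIA X L ↔
    (⨆ c ∈ P.C, observe (P.insObs {c}) L ⊓ observe (P.admObs X c) L) ≤ L := by
  rw [iSup₂_le_iff]
  constructor
  · rintro h c hc _ ⟨⟨u, hu, rfl | ⟨w₁, w₂, _, rfl, hC, rfl, rfl⟩⟩, hA⟩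
    -- In the identity branch the word is already in `L`, whatever the intersection with the
    -- admissibility observer says.
    · exact hu
    · exact h w₁ w₂ hu hC _ hc ((append_cons_mem_observe_admObs hc hC).1 hA)
  · exact fun h w₁ w₂ hw hC c hc hA => h c hc ⟨⟨_, hw, .inr ⟨w₁, w₂, c, rfl, hC, rfl, rfl⟩⟩,
      (append_cons_mem_observe_admObs hc hC).2 hA⟩

theorem IA_iff : P.IA X L ↔
    (⨆ c ∈ P.C,
      observe (projObs P.Nᶜ) (observe (P.insObs {c}) L ⊓ observe (P.admObs X c) L)) ≤
    observe (projObs P.Nᶜ) L := by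
  rw [iSup₂_le_iff]
  constructor
  · rintro h c hc _ ⟨w, ⟨⟨u, hu, rfl | ⟨w₁, w₂, _, rfl, hC, rfl, rfl⟩⟩, hA⟩, rfl⟩
    · exact ⟨_, hu, rfl⟩
    · obtain ⟨w₁', w₂', h₁, h₂, h⟩ :=
        h w₁ w₂ hu hC _ hc ((append_cons_mem_observe_admObs hc hC).1 hA)
      exact ⟨_, h, simN_append_cons _ h₁ h₂⟩
  · intro h w₁ w₂ hw hC c hc hA
    obtain ⟨w, hw, he⟩ := h c hc ⟨w₁ ++ c :: w₂, ⟨⟨_, hw, .inr ⟨w₁, w₂, c, rfl, hC, rfl, rfl⟩⟩,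
      (append_cons_mem_observe_admObs hc hC).2 hA⟩, rfl⟩
    obtain ⟨w₁', w₂', h₁, h₂, rfl⟩ := exists_simN_append_cons hc he.symm
    exact ⟨w₁', w₂', h₁, h₂, hw⟩

theorem BSIA_iff : P.BSIA X L ↔
    (⨆ c ∈ P.C, observe (P.bsiObs₁ {c}) L ⊓ observe (P.admObs X c) L) ≤
    observe P.bsiObs₂ L := by
  rw [iSup₂_le_iff]
  constructor
  · rintro h c hc _ ⟨⟨u, hu, rfl | ⟨w₁, w₂, _, rfl, hC, rfl, rfl⟩⟩, hA⟩
    · exact ⟨_, hu, .inl rfl⟩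
    · exact (mem_observe_bsiObs₂_iff hc hC).2 (h w₁ w₂ hu hC _ hc
        -- Admissibility is read off the code, whose tail is `π_V(w₂)` instead of `w₂`; only `w₁`
        -- and `c` matter.
        ((append_cons_mem_observe_admObs hc P.proj_C_proj_V).1 hA))
  · exact fun h w₁ w₂ hw hC c hc hA => (mem_observe_bsiObs₂_iff hc hC).1
      (h c hc ⟨⟨_, hw, .inr ⟨w₁, w₂, c, rfl, hC, rfl, rfl⟩⟩,
        (append_cons_mem_observe_admObs hc P.proj_C_proj_V).2 hA⟩)

theorem FCIA_iff (hV : V' ⊆ P.V) (hC' : C' ⊆ P.C) : P.FCIA X V' C' N' L ↔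
    (⨆ c ∈ C', observe (P.fciObs₁ V' {c}) L ⊓ observe (P.admObs X c) L) ≤
    observe (P.fciObs₂ V' C' N') L := by
  have hCV {x : A} {w : List A} (hx : x ∈ V') : proj P.C (x :: proj P.V w) = [] :=
    (P.proj_C_cons_of_mem_V (hV hx)).trans P.proj_C_proj_V
  rw [iSup₂_le_iff]
  constructor
  · rintro h c hc _ ⟨⟨u, hu, rfl | ⟨w₁, w₂, _, rfl, v, hv, hC, rfl, rfl⟩⟩, hA⟩
    · exact ⟨_, hu, .inl rfl⟩
    · exact (mem_observe_fciObs₂_iff hV hC' hc hv hC).2 (h w₁ w₂ v hv hu hC _ hc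
        ((append_cons_mem_observe_admObs (hC' hc) (hCV hv)).1 hA))
  · exact fun h w₁ w₂ v hv hw hC c hc hA => (mem_observe_fciObs₂_iff hV hC' hc hv hC).1
      (h c hc ⟨⟨_, hw, .inr ⟨w₁, w₂, c, rfl, v, hv, hC, rfl, rfl⟩⟩,
        (append_cons_mem_observe_admObs (hC' hc) (hCV hv)).2 hA⟩)

end View

/-! ### Rational information flow properties -/

section RIF

theorem Transducer.isRational {A B : Type*} {n : ℕ} {T : Transducer A B (Fin n)}
    {O : SetRel (List A) (List B)} (h : T.rel = O) : IsRational O :=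
  ⟨Fin n, inferInstance, T, h⟩

universe u

variable {A : Type u} [Finite A]

/-- The grammar has no constant for the empty language; applying the empty observer supplies it, as
needed for a union over an empty set of letters. -/
theorem isRational_empty {A B : Type*} : IsRational (∅ : SetRel (List A) (List B)) :=
  ⟨Fin 1, inferInstance, ⟨∅, ∅, Set.finite_empty, ∅⟩, by simp [Transducer.rel]⟩

/-- Finite unions of expressions are expressions. -/
theorem RatExpr.exists_eval_eq_iSup {B : Type u} [Finite B] (S : Set A) (e : A → RatExpr A B) :
    ∃ e' : RatExpr A B, ∀ L, e'.eval L = ⨆ c ∈ S, (e c).eval L := by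
  induction S, S.toFinite using Set.Finite.induction_on with
  | empty =>
    refine ⟨.obs ∅ isRational_empty .lang, fun L => ?_⟩
    simp only [Set.mem_empty_iff_false, iSup_false, iSup_bot, eval, eq_bot_iff]
    rintro v ⟨u, -, h⟩
    exact h
  | @insert c S _ _ ih =>
    obtain ⟨e', h⟩ := ih
    exact ⟨.union (e c) e', fun L => by rw [eval, h, iSup_insert]⟩

/-- An inclusion between two rational observations is a rational information flow property. -/
theorem mem_RIF_of_observe {B : Type u} [Finite B] {φ : Language A → Prop}
    {O₁ O₂ : SetRel (List A) (List B)} (h₁ : IsRational O₁) (h₂ : IsRational O₂)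
    (h : ∀ L, φ L ↔ observe O₁ L ≤ observe O₂ L) (𝓛 : Set (Language A)) : φ ∈ RIF 𝓛 :=
  ⟨B, inferInstance, .obs O₁ h₁ .lang, .obs O₂ h₂ .lang, fun L _ => h L⟩

theorem mem_RIF_of_observe_le {φ : Language A → Prop} {O : SetRel (List A) (List A)}
    (hO : IsRational O) (h : ∀ L, φ L ↔ observe O L ≤ L) (𝓛 : Set (Language A)) : φ ∈ RIF 𝓛 :=
  ⟨A, inferInstance, .obs O hO .lang, .lang, fun L _ => h L⟩

theorem mem_RIF_of_iSup {B : Type u} [Finite B] {φ : Language A → Prop} (S : Set A)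
    (e : A → RatExpr A B) (e' : RatExpr A B)
    (h : ∀ L, φ L ↔ (⨆ c ∈ S, (e c).eval L) ≤ e'.eval L) (𝓛 : Set (Language A)) : φ ∈ RIF 𝓛 := by
  obtain ⟨e'', he⟩ := RatExpr.exists_eval_eq_iSup S e
  exact ⟨B, inferInstance, e'', e', fun L _ => by rw [h, he]⟩

theorem BSP.sat_mem_RIF {P : View A} (b : BSP P) (𝓛 : Set (Language A)) : b.Sat ∈ RIF 𝓛 := by
  cases b with
  | SR => exact mem_RIF_of_observe_le (isRational (rel_projT _)) (fun _ => View.SR_iff) 𝓛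
  | R =>
    exact mem_RIF_of_observe (isRational (rel_projT _)) (isRational (rel_projT _))
      (fun _ => View.R_iff) 𝓛
  | SD => exact mem_RIF_of_observe_le (isRational P.rel_lDelT) (fun _ => View.SD_iff_lDelObs) 𝓛
  | D =>
    exact mem_RIF_of_observe (isRational P.rel_lDelT_ignoring_N) (isRational (rel_projT _))
      (fun _ => View.D_iff) 𝓛
  | BSD =>
    exact mem_RIF_of_observe (isRational P.rel_bsdT₁) (isRational P.rel_bsdT₂)
      (fun _ => View.BSD_iff) 𝓛
  | FCD V' C' N' hV hC hN =>
    exact mem_RIF_of_observe (isRational (P.rel_fcdT₁ hV C')) (isRational (P.rel_fcdT₂ hV N'))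
      (fun _ => View.FCD_iff hV) 𝓛
  | SI => exact mem_RIF_of_observe_le (isRational (P.rel_insT _)) (fun _ => View.SI_iff) 𝓛
  | I =>
    exact mem_RIF_of_observe (isRational (P.rel_insT_ignoring_N subset_rfl))
      (isRational (rel_projT _)) (fun _ => View.I_iff) 𝓛
  | BSI =>
    exact mem_RIF_of_observe (isRational (P.rel_bsiT₁ _)) (isRational P.rel_bsiT₂)
      (fun _ => View.BSI_iff) 𝓛
  | FCI V' C' N' hV hC hN =>
    exact mem_RIF_of_observe (isRational (P.rel_fciT₁ V' C')) (isRational (P.rel_fciT₂ V' C' N'))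
      (fun _ => View.FCI_iff hV hC) 𝓛
  | SIA X =>
    exact mem_RIF_of_iSup P.C
      (fun c => .inter (.obs _ (isRational (P.rel_insT {c})) .lang)
        (.obs _ (isRational (P.rel_admT X c)) .lang)) .lang (fun _ => View.SIA_iff) 𝓛
  | IA X =>
    exact mem_RIF_of_iSup P.C
      (fun c => .obs _ (isRational (rel_projT P.Nᶜ))
        (.inter (.obs _ (isRational (P.rel_insT {c})) .lang)
          (.obs _ (isRational (P.rel_admT X c)) .lang)))
      (.obs _ (isRational (rel_projT P.Nᶜ)) .lang) (fun _ => View.IA_iff) 𝓛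
  | BSIA X =>
    exact mem_RIF_of_iSup P.C
      (fun c => .inter (.obs _ (isRational (P.rel_bsiT₁ {c})) .lang)
        (.obs _ (isRational (P.rel_admT X c)) .lang))
      (.obs _ (isRational P.rel_bsiT₂) .lang) (fun _ => View.BSIA_iff) 𝓛
  | FCIA X V' C' N' hV hC hN =>
    exact mem_RIF_of_iSup C'
      (fun c => .inter (.obs _ (isRational (P.rel_fciT₁ V' {c})) .lang)
        (.obs _ (isRational (P.rel_admT X c)) .lang))
      (.obs _ (isRational (P.rel_fciT₂ V' C' N')) .lang) (fun _ => View.FCIA_iff hV hC) 𝓛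

end RIF

end InfoFlow

theorem mainTheorem3 {A : Type*} [Finite A] (P : View A) :
    -- every basic security predicate is a rational information flow property
    (∀ (𝓛 : Set (Language A)) (b : BSP P), b.Sat ∈ RIF 𝓛) ∧
    -- the explicit transducers realize the observers used below
    ((∀ B : Set A, (projT B).rel = projObs B) ∧
      (P.lDelT Set.univ).rel = P.lDelObs ∧
      IsRational {p : List A × List A | p.2 = delLast P.C p.1} ∧
      ((P.lDelT P.Nᶜ).ignoring P.N).rel = P.lDelObs.comp (projObs P.Nᶜ) ∧
      P.delT.rel = P.delObs ∧
      P.bsdT₁.rel = P.bsdObs₁ ∧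
      P.bsdT₂.rel = P.bsdObs₂ ∧
      (∀ V' ⊆ P.V, ∀ C' ⊆ P.C, (P.fcdT₁ V' C').rel = P.fcdObs₁ V' C') ∧
      (∀ V' ⊆ P.V, ∀ N' ⊆ P.N, (P.fcdT₂ V' N').rel = P.fcdObs₂ V' N') ∧
      (∀ E ⊆ P.C, (P.insT Set.univ E).rel = P.insObs E) ∧
      (∀ E ⊆ P.C, ((P.insT P.Nᶜ E).ignoring P.N).rel = (P.insObs E).comp (projObs P.Nᶜ)) ∧
      (∀ E ⊆ P.C, (P.bsiT₁ E).rel = P.bsiObs₁ E) ∧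
      P.bsiT₂.rel = P.bsiObs₂ ∧
      (∀ V' ⊆ P.V, ∀ E ⊆ P.C, (P.fciT₁ V' E).rel = P.fciObs₁ V' E) ∧
      (∀ V' ⊆ P.V, ∀ C' ⊆ P.C, ∀ N' ⊆ P.N,
        (P.fciT₂ V' C' N').rel = P.fciObs₂ V' C' N') ∧
      (∀ (X : Set A), ∀ c ∈ P.C, (P.admT X c).rel = P.admObs X c)) ∧
    -- and each predicate is the corresponding inclusion between observations
    (∀ L : Language A,
      (P.SR L ↔ observe (projObs P.Cᶜ) L ≤ L) ∧
      (P.R L ↔ observe (projObs P.V) L ≤ observe (projObs P.Nᶜ) L) ∧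
      (P.SD L ↔ observe {p | p.2 = delLast P.C p.1} L ≤ L) ∧
      (P.SD L ↔ observe P.lDelObs L ≤ L) ∧
      (P.SD L ↔ observe P.delObs L ≤ L) ∧
      (P.D L ↔ observe (P.lDelObs.comp (projObs P.Nᶜ)) L ≤ observe (projObs P.Nᶜ) L) ∧
      (P.BSD L ↔ observe P.bsdObs₁ L ≤ observe P.bsdObs₂ L) ∧
      (∀ V' ⊆ P.V, ∀ C' ⊆ P.C, ∀ N' ⊆ P.N,
        (P.FCD V' C' N' L ↔ observe (P.fcdObs₁ V' C') L ≤ observe (P.fcdObs₂ V' N') L)) ∧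
      (P.SI L ↔ observe (P.insObs P.C) L ≤ L) ∧
      (P.I L ↔
        observe ((P.insObs P.C).comp (projObs P.Nᶜ)) L ≤ observe (projObs P.Nᶜ) L) ∧
      (P.BSI L ↔ observe (P.bsiObs₁ P.C) L ≤ observe P.bsiObs₂ L) ∧
      (∀ V' ⊆ P.V, ∀ C' ⊆ P.C, ∀ N' ⊆ P.N,
        (P.FCI V' C' N' L ↔
          observe (P.fciObs₁ V' C') L ≤ observe (P.fciObs₂ V' C' N') L)) ∧
      (∀ X : Set A,
        (P.SIA X L ↔
          (⨆ c ∈ P.C, observe (P.insObs {c}) L ⊓ observe (P.admObs X c) L) ≤ L)) ∧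
      (∀ X : Set A,
        (P.IA X L ↔
          (⨆ c ∈ P.C,
            observe (projObs P.Nᶜ) (observe (P.insObs {c}) L ⊓ observe (P.admObs X c) L)) ≤
          observe (projObs P.Nᶜ) L)) ∧
      (∀ X : Set A,
        (P.BSIA X L ↔
          (⨆ c ∈ P.C, observe (P.bsiObs₁ {c}) L ⊓ observe (P.admObs X c) L) ≤
          observe P.bsiObs₂ L)) ∧
      (∀ X : Set A, ∀ V' ⊆ P.V, ∀ C' ⊆ P.C, ∀ N' ⊆ P.N,
        (P.FCIA X V' C' N' L ↔
          (⨆ c ∈ C', observe (P.fciObs₁ V' {c}) L ⊓ observe (P.admObs X c) L) ≤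
          observe (P.fciObs₂ V' C' N') L))) :=
  ⟨fun 𝓛 b => b.sat_mem_RIF 𝓛,
    ⟨rel_projT, P.rel_lDelT, P.isRational_delLast, P.rel_lDelT_ignoring_N, P.rel_delT,
      P.rel_bsdT₁, P.rel_bsdT₂, fun _ hV C' _ => P.rel_fcdT₁ hV C',
      fun _ hV N' _ => P.rel_fcdT₂ hV N', fun E _ => P.rel_insT E,
      fun _ hE => P.rel_insT_ignoring_N hE, fun E _ => P.rel_bsiT₁ E, P.rel_bsiT₂,
      fun V' _ E _ => P.rel_fciT₁ V' E, fun V' _ C' _ N' _ => P.rel_fciT₂ V' C' N',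
      fun X c _ => P.rel_admT X c⟩,
    fun _ => ⟨View.SR_iff, View.R_iff, View.SD_iff_delLast, View.SD_iff_lDelObs,
      View.SD_iff_delObs, View.D_iff, View.BSD_iff, fun _ hV _ _ _ _ => View.FCD_iff hV,
      View.SI_iff, View.I_iff, View.BSI_iff, fun _ hV _ hC _ _ => View.FCI_iff hV hC,
      fun _ => View.SIA_iff, fun _ => View.IA_iff, fun _ => View.BSIA_iff,
      fun _ _ hV _ hC _ _ => View.FCIA_iff hV hC⟩⟩
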